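/- Let $L>0$, $\Omega=[0,L]^2$, $\lambda>0$, and let $u$ be a solution, periodic with respect to $\Omega$, of the two-dimensional modified Kuramoto–Sivashinsky equation $$u_t=-\Delta^2u-\Delta u+\lambda u-u^3-u(u_x+u_y),\qquad u(\cdot,0)=u_0\in L^2(\Omega),$$ that is, $u$ is $C^\infty$ and satisfies the equation for $t>0$, and $u(\cdot,t)\to u_0$ in $L^2(\Omega)$ as $t\to0^+$. Put $$J_n(t)=\sum_{i+j=n}\frac{n!}{i!\,j!}\,\|\partial_x^i\partial_y^j u(\cdot,t)\|_{L^2(\Omega)}^2,\qquad u'=u-L^{-2}\int_\Omega u\,dx\,dy,\qquad \overline J_0=\limsup_{t\to\infty}J_0(t),$$ and, for $F\ge 0$, $\langle F\rangle=\limsup_{T\to\infty}\frac1T\int_{t_0}^{t_0+T}F(t)\,dt$, where $t_0>0$ is any fixed starting time. Let $$\widetilde C_f=\Big\langle L\,\frac{\|u\|_\infty}{J_0^{1/2}}\Big\rangle,\qquad \overline C_f=\Big\langle L\,\frac{\|u'\|_\infty}{J_0^{1/2}}\Big\rangle$$ (quotients with denominator $0$, which can occur only when the numerator also vanishes, are read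 as $0$). Then, for every such solution and every $t_0>0$: 1. $\widetilde C_f\le 1+\overline C_f$ and, with $c(2)=\pi^{-1/2}$, $$\overline C_f\le c(2)\,L\,\Big\langle\Big(\frac{J_2}{J_0}\Big)^{1/4}\Big\rangle\le c(2)\,L\,\Big\langle\frac{J_2}{J_0}\Big\rangle^{1/4}.$$ 2. $\langle J_0\rangle\le\overline J_0\le B_0:=L^2(\lambda+\tfrac14)$. 3. $\langle J_2\rangle\le(2\lambda+1)\langle J_0\rangle$ and $\langle J_2\rangle\le(2\lambda+1)L^2(\lambda+\tfrac14)$. 4. $\langle J_1\rangle\le\langle J_2\rangle^{1/2}\langle J_0\rangle^{1/2}$, $\langle J_1\rangle\le(2\lambda+1)^{1/2}\langle J_0\rangle$, and $\langle J_1\rangle\le B_1:=(2\lambda+1)^{1/2}L^2(\lambda+\tfrac14)$. 5. $\langle J_3\rangle\le\langle J_2\rangle+\lambda\langle J_1\rangle+\sqrt{24/\pi}\,\langle J_2\rangle\,\overline J_0^{1/2}$ and $$\langle J_3\rangle\le B_3:=(2\lambda+1)^{1/2}L^2\Big(\lambda+\frac14\Big)\Big[\lambda+(2\lambda+1)^{1/2}\Big(1+\sqrt{\tfrac{24}{\pi}}\,L\big(\lambda+\tfrac14\big)^{1/2}\Big)\Big].$$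 6. Suppose in addition that $u$ does not decay to zero exponentially fast, in the sense that for every $\varepsilon>0$ one has $J_0(t)+J_2(t)\ge e^{-\varepsilon t}$ for all sufficiently large $t$ (for instance, $J_2$ or $J_0$ is bounded from below by a positive constant for large times). Then $$\Big\langle\frac{J_2}{J_0}\Big\rangle\le(2\lambda+1)+\frac{156}{\pi}\langle J_1\rangle+\frac{10}{\sqrt\pi}\langle J_3\rangle^{1/4}\langle J_1\rangle^{1/4},$$ and hence $$\overline C_f\le \pi^{-1/2}L\Big(2\lambda+1+\frac{156}{\pi}B_1+\frac{10}{\sqrt\pi}B_3^{1/4}B_1^{1/4}\Big)^{1/4}.$$ Consequently, for every $L>0$ there is a constant $K=K(L)$ such that for all $\lambda\ge1$, all solutions $u$ that satisfy the condition in 6, and all $t_0>0$, $$\overline C_f\le K\lambda^{3/8},\qquad 1\le\widetilde C_f\le1+K\lambda^{3/8},$$ that is, $\widetilde C_f=1+O(\lambda^{3/8})$ for large $\lambda$. -/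

import Mathlib

open MeasureTheory Filter Topology
open scoped ContDiff ENNReal

noncomputable section

namespace MKS

/-- The fundamental cell `[0, L]²` of the two-dimensional torus. -/
def cell (L : ℝ) : Set (ℝ × ℝ) := Set.Icc 0 L ×ˢ Set.Icc 0 L

/-- The partial derivative with respect to the first space variable. -/
def dx (φ : ℝ × ℝ → ℝ) : ℝ × ℝ → ℝ := fun p => deriv (fun s => φ (s, p.2)) p.1

/-- The partial derivative with respect to the second space variable. -/
def dy (φ : ℝ × ℝ → ℝ) : ℝ × ℝ → ℝ := fun p => deriv (fun s => φ (p.1, s)) p.2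

/-- The mixed partial derivative `∂^(m+n) φ / ∂x^m ∂y^n`. -/
def mixedDeriv (m n : ℕ) (φ : ℝ × ℝ → ℝ) : ℝ × ℝ → ℝ := dx^[m] (dy^[n] φ)

/-- The Laplacian in two space variables. -/
def lap (φ : ℝ × ℝ → ℝ) : ℝ × ℝ → ℝ := fun p => dx (dx φ) p + dy (dy φ) p

/-- `J_n = ∑_{i + j = n} n! / (i! j!) ‖∂_x^i ∂_y^j φ‖₂²`. -/
def J (L : ℝ) (n : ℕ) (φ : ℝ × ℝ → ℝ) : ℝ :=
  ∑ ij ∈ Finset.HasAntidiagonal.antidiagonal n,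
    (n.choose ij.1 : ℝ) * ∫ p in cell L, (mixedDeriv ij.1 ij.2 φ p) ^ 2

/-- The sup-norm over the cell. -/
def supNorm (L : ℝ) (φ : ℝ × ℝ → ℝ) : ℝ := sSup ((fun p => |φ p|) '' cell L)

/-- The space average of `φ` over the cell. -/
def mean (L : ℝ) (φ : ℝ × ℝ → ℝ) : ℝ := (∫ p in cell L, φ p) / L ^ 2

/-- The mean-zero part of `φ`. -/
def fluct (L : ℝ) (φ : ℝ × ℝ → ℝ) : ℝ × ℝ → ℝ := fun p => φ p - mean L φ

/-- `u` is the solution, with square-integrable initial datum `u₀`, of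
`u_t = - Δ² u - Δ u + lam u - u³ - u (u_x + u_y)` on the torus `[0, L]²`:
it is smooth and solves the equation for positive times, and it attains `u₀` in `L²`. -/
structure IsSolution (L lam : ℝ) (u₀ : ℝ × ℝ → ℝ) (u : ℝ → ℝ × ℝ → ℝ) : Prop where
  datum : MemLp u₀ 2 (volume.restrict (cell L))
  initial : Tendsto (fun t => ∫ p in cell L, (u t p - u₀ p) ^ 2) (𝓝[>] 0) (𝓝 0)
  smooth : ContDiffOn ℝ ∞ (Function.uncurry u) (Set.Ioi (0 : ℝ) ×ˢ Set.univ)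
  periodic_x : ∀ t > 0, ∀ x y, u t (x + L, y) = u t (x, y)
  periodic_y : ∀ t > 0, ∀ x y, u t (x, y + L) = u t (x, y)
  pde : ∀ t > 0, ∀ p, deriv (fun s => u s p) t =
    - lap (lap (u t)) p - lap (u t) p + lam * u t p - (u t p) ^ 3
      - u t p * (dx (u t) p + dy (u t) p)

/-- The time average `⟨F⟩ = limsup_{T → ∞} (1/T) ∫_{t₀}^{t₀+T} F(t) dt` of a nonnegative function
`F`, as an extended nonnegative number. -/
def timeAvg (t₀ : ℝ) (F : ℝ → ℝ) : ℝ≥0∞ :=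
  limsup (fun T : ℝ =>
    (∫⁻ t in Set.Ioc t₀ (t₀ + T), ENNReal.ofReal (F t)) / ENNReal.ofReal T) atTop

/-- The time-asymptotic value `limsup_{t → ∞} F(t)` of a nonnegative function `F`. -/
def asymp (F : ℝ → ℝ) : ℝ≥0∞ := limsup (fun t : ℝ => ENNReal.ofReal (F t)) atTop

/-- The time-averaged crest factor `⟨L ‖u‖_∞ / J₀^(1/2)⟩`. -/
def crestAvg (L t₀ : ℝ) (u : ℝ → ℝ × ℝ → ℝ) : ℝ≥0∞ :=
  timeAvg t₀ fun t => L * (supNorm L (u t) / √(J L 0 (u t)))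

/-- The time-averaged crest factor `⟨L ‖u'‖_∞ / J₀^(1/2)⟩` of the mean-zero part `u'`. -/
def crestFluct (L t₀ : ℝ) (u : ℝ → ℝ × ℝ → ℝ) : ℝ≥0∞ :=
  timeAvg t₀ fun t => L * (supNorm L (fluct L (u t)) / √(J L 0 (u t)))

/-- The solution does not decay to zero exponentially fast in `H²`. This holds in particular when
`J₀` or `J₂` is bounded from below by a positive constant for large times. -/
def NoExpDecay (L : ℝ) (u : ℝ → ℝ × ℝ → ℝ) : Prop :=
  ∀ ε > 0, ∀ᶠ t : ℝ in atTop, Real.exp (- ε * t) ≤ J L 0 (u t) + J L 2 (u t)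

/-- The explicit bound of `J₀`. -/
def B0 (L lam : ℝ) : ℝ := L ^ 2 * (lam + 1 / 4)

/-- The explicit bound of `⟨J₁⟩`. -/
def B1 (L lam : ℝ) : ℝ := √(2 * lam + 1) * (L ^ 2 * (lam + 1 / 4))

/-- The explicit bound of `⟨J₂⟩`. -/
def B2 (L lam : ℝ) : ℝ := (2 * lam + 1) * L ^ 2 * (lam + 1 / 4)

/-- The explicit bound of `⟨J₃⟩`. -/
def B3 (L lam : ℝ) : ℝ :=
  √(2 * lam + 1) * L ^ 2 * (lam + 1 / 4) *
    (lam + √(2 * lam + 1) * (1 + √(24 / Real.pi) * L * √(lam + 1 / 4)))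

end MKS

end

/-!
The estimates rest on two ingredients: an inequality of Agmon type on the torus and energy
inequalities for `J₀` and `J₁`.

Agmon's inequality `‖u'‖_∞² ≤ π⁻¹ ‖u‖ ‖Δu‖` (`fluct_sq_le`) comes from the absolutely convergent
Fourier series of the mean-zero part `u'`. The Cauchy–Schwarz inequality with the
weights `a + |k|²` leaves the lattice sum of `(a + |k|²)⁻²` over `k ≠ 0`, which is at
most `π / a` (`sum_inv_sq_le`): the summand is the Laplace transform of `t exp (-t |k|²)`, and the theta series satisfies
`θ(t)² ≤ 1 + π / t`. This last bound is invariant under Jacobi's transformation, so that it only has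
to be checked where the series is dominated by a geometric one. The best choice of `a` gives the
constant `π⁻¹`.

Testing the equation with `u` gives `J₀' ≤ 2 L⁻² J₀ (B₀ - J₀)`, hence the asymptotic bound of
`J₀`, and also `J₀' ≤ (2 λ + 1) J₀ - J₂`, hence the bound of the averaged `J₂`. Testing with `-Δu`
bounds the averaged `J₃`: the transport term is `∫ u' (u_x + u_y) Δu`, because `(u_x + u_y) Δu` is
a divergence, and Agmon's inequality controls it by `J₂ √J₀`. The bound of `J₁` is interpolation,
`J₁² ≤ J₀ J₂`.

For the quotient, `J₂ / J₀ ≤ 2 λ + 1 - (log J₀)'`. Integrating up to a time at which `J₀` is not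
exponentially small bounds the average of `J₂ / J₀` by `2 λ + 1` alone (`timeAvg_ratio_le`), so
the further nonnegative terms of the stated bound are not needed. Such times exist in every late
window of length one (`exists_le_J_zero`): if `J₀` were exponentially small throughout the window,
`J₂` could not be, and the dissipation would make `J₀` negative.
-/

namespace MKS

/-! ### A lattice sum -/

lemma exp_neg_mul_int_sq_le {s : ℝ} (hs : 0 < s) (n : ℤ) :
    Real.exp (-Real.pi * s * (n : ℝ) ^ 2) ≤ Real.exp (-Real.pi * s) ^ n.natAbs := by
  rw [← Real.exp_nat_mul]
  apply Real.exp_le_exp.2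
  have h1 : ((n.natAbs : ℕ) : ℝ) ≤ (n : ℝ) ^ 2 := by
    have := Int.natAbs_le_self_sq n
    rw [Nat.cast_natAbs]
    exact_mod_cast (by simpa using this : |n| ≤ n ^ 2)
  nlinarith [mul_pos (show 0 < Real.pi by positivity) hs]

lemma hasSum_pow_natAbs {q : ℝ} (hq0 : 0 ≤ q) (hq1 : q < 1) :
    HasSum (fun n : ℤ => q ^ n.natAbs) ((1 + q) / (1 - q)) := by
  have h1 : HasSum (fun n : ℕ => q ^ n) (1 - q)⁻¹ := hasSum_geometric_of_lt_one hq0 hq1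
  have := HasSum.of_nat_of_neg_add_one (f := fun n : ℤ => q ^ n.natAbs) (m := (1 - q)⁻¹)
    (m' := q * (1 - q)⁻¹)
    (by simpa using h1) (by
      have := h1.mul_left q
      refine this.congr_fun (fun n => ?_)
      have : (-((n : ℤ) + 1)).natAbs = n + 1 := by omega
      simp only [this, pow_succ'])
  convert this using 1
  have : 1 - q ≠ 0 := by linarith
  field_simp

lemma summable_exp_neg_mul_int_sq {s : ℝ} (hs : 0 < s) :
    Summable fun n : ℤ => Real.exp (-Real.pi * s * (n : ℝ) ^ 2) := by
  refine Summable.of_nonneg_of_le (fun n => (Real.exp_pos _).le) (exp_neg_mul_int_sq_le hs)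
    (hasSum_pow_natAbs (Real.exp_pos _).le (Real.exp_lt_one_iff.mpr ?_)).summable
  nlinarith [Real.pi_pos]

/-- The squared theta series is at most `1 + 1 / s` for `1 ≤ s`, by comparison with a geometric
series. -/
lemma theta_sq_le_of_one_le {s : ℝ} (hs : 1 ≤ s) :
    (∑' n : ℤ, Real.exp (-Real.pi * s * (n : ℝ) ^ 2)) ^ 2 ≤ 1 + 1 / s := by
  have hs0 : 0 < s := by linarith
  set q := Real.exp (-Real.pi * s) with hq
  have hq0 : 0 < q := Real.exp_pos _
  have hpi := Real.pi_gt_three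
  have hsq : s * q ≤ 1 / 8 := by
    have h1 : 3 * s ≤ Real.pi * s := by gcongr
    have h2 : q ≤ Real.exp (-(3 * s)) := Real.exp_le_exp.2 (by linarith)
    have h3 : 8 * s ≤ Real.exp (3 * s) := by
      have := Real.exp_one_gt_d9
      have e3 : (8 : ℝ) ≤ Real.exp 3 := by
        have : Real.exp 3 = Real.exp 1 ^ 3 := by rw [← Real.exp_nat_mul]; norm_num
        rw [this]
        calc (8 : ℝ) = 2 ^ 3 := by norm_num
          _ ≤ _ := by gcongr; linarith
      have e4 := Real.add_one_le_exp (3 * (s - 1))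
      have : Real.exp (3 * s) = Real.exp 3 * Real.exp (3 * (s - 1)) := by
        rw [← Real.exp_add]; ring_nf
      rw [this]
      nlinarith [Real.exp_pos (3 * (s - 1))]
    have h4 : Real.exp (-(3 * s)) * Real.exp (3 * s) = 1 := by
      rw [← Real.exp_add]; simp
    nlinarith [Real.exp_pos (-(3 * s))]
  have hq1 : q ≤ 1 / 8 := by nlinarith
  have hle : ∑' n : ℤ, Real.exp (-Real.pi * s * (n : ℝ) ^ 2) ≤ (1 + q) / (1 - q) :=
    hasSum_le (exp_neg_mul_int_sq_le hs0) (summable_exp_neg_mul_int_sq hs0).hasSum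
      (hasSum_pow_natAbs hq0.le (by linarith))
  have h0 : 0 ≤ ∑' n : ℤ, Real.exp (-Real.pi * s * (n : ℝ) ^ 2) :=
    tsum_nonneg fun n => (Real.exp_pos _).le
  calc _ ≤ ((1 + q) / (1 - q)) ^ 2 := by gcongr
    _ ≤ 1 + 1 / s := by
      have h1q : 0 < 1 - q := by linarith
      rw [div_pow, div_le_iff₀ (by positivity)]
      have : (1 + 1 / s) * (1 - q) ^ 2 = (1 - q) ^ 2 + (1 - q) ^ 2 / s := by ring
      rw [this]
      have h2 : 4 * q ≤ (1 - q) ^ 2 / s := by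
        rw [le_div_iff₀ hs0]; nlinarith
      nlinarith

/-- The squared theta series is at most `1 + 1 / s`. Both sides obey the same transformation law
under `s ↦ 1 / s`, which reduces the claim to `1 ≤ s`. -/
lemma theta_sq_le {s : ℝ} (hs : 0 < s) :
    (∑' n : ℤ, Real.exp (-Real.pi * s * (n : ℝ) ^ 2)) ^ 2 ≤ 1 + 1 / s := by
  rcases le_total 1 s with h | h
  · exact theta_sq_le_of_one_le h
  · rw [Real.tsum_exp_neg_mul_int_sq hs, mul_pow]
    have h1 := theta_sq_le_of_one_le (s := 1 / s) (by rw [le_div_iff₀ hs]; linarith)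
    have h2 : (1 / s ^ (1 / 2 : ℝ)) ^ 2 = 1 / s := by
      rw [← Real.sqrt_eq_rpow, div_pow, Real.sq_sqrt hs.le, one_pow]
    rw [h2]
    have h3 : ∀ n : ℤ, Real.exp (-Real.pi / s * (n : ℝ) ^ 2)
        = Real.exp (-Real.pi * (1 / s) * (n : ℝ) ^ 2) := fun n => by congr 1; ring
    simp_rw [h3]
    calc _ ≤ 1 / s * (1 + 1 / (1 / s)) := by gcongr
      _ = 1 + 1 / s := by field_simp; ring

/-- The squared length of a frequency. -/
def freqSq (k : Fin 2 → ℤ) : ℝ := (k 0 : ℝ) ^ 2 + (k 1 : ℝ) ^ 2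

lemma freqSq_nonneg (k : Fin 2 → ℤ) : 0 ≤ freqSq k := by unfold freqSq; positivity

lemma sum_exp_neg_freqSq_le {F : Finset (Fin 2 → ℤ)} (hF : (0 : Fin 2 → ℤ) ∉ F) {t : ℝ}
    (ht : 0 < t) : ∑ k ∈ F, Real.exp (-(t * freqSq k)) ≤ Real.pi / t := by
  classical
  have hpi := Real.pi_pos
  set s := t / Real.pi with hs
  have hs0 : 0 < s := by positivity
  set g : ℤ → ℝ := fun n => Real.exp (-Real.pi * s * (n : ℝ) ^ 2) with hg
  have hprod : ∀ k : Fin 2 → ℤ, Real.exp (-(t * freqSq k)) = ∏ i, g (k i) := by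
    intro k
    simp only [hg, Fin.prod_univ_two, ← Real.exp_add, freqSq, hs]
    congr 1
    field_simp
    ring
  set G : Fin 2 → Finset ℤ := fun i => (insert 0 F).image (fun k => k i) with hG
  have hsub : insert 0 F ⊆ Fintype.piFinset G := by
    intro k hk
    rw [Fintype.mem_piFinset]
    intro i
    exact Finset.mem_image_of_mem (fun k : Fin 2 → ℤ => k i) hk
  have hθ : ∀ i, ∑ n ∈ G i, g n ≤ ∑' n, g n := fun i =>
    (summable_exp_neg_mul_int_sq hs0).sum_le_tsum _ fun _ _ => (Real.exp_pos _).le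
  have h1 : ∑ k ∈ insert 0 F, ∏ i, g (k i) ≤ (∑' n, g n) ^ 2 := by
    calc _ ≤ ∑ k ∈ Fintype.piFinset G, ∏ i, g (k i) :=
          Finset.sum_le_sum_of_subset_of_nonneg hsub
            fun _ _ _ => Finset.prod_nonneg fun _ _ => (Real.exp_pos _).le
      _ = ∏ i, ∑ n ∈ G i, g n := (Finset.prod_univ_sum G fun _ n => g n).symm
      _ ≤ ∏ _i : Fin 2, ∑' n, g n := Finset.prod_le_prod
            (fun _ _ => Finset.sum_nonneg fun _ _ => (Real.exp_pos _).le) fun i _ => hθ i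
      _ = _ := by simp
  rw [Finset.sum_insert hF] at h1
  have h2 : ∏ i, g ((0 : Fin 2 → ℤ) i) = 1 := by simp [hg]
  have h3 := theta_sq_le hs0
  have h4 : 1 / s = Real.pi / t := by rw [hs, one_div_div]
  simp_rw [hprod]
  linarith

lemma integrableOn_and_integral_mul_exp_neg {c : ℝ} (hc : 0 < c) :
    IntegrableOn (fun t : ℝ => t * Real.exp (-(c * t))) (Set.Ioi 0) ∧
      ∫ t in Set.Ioi (0 : ℝ), t * Real.exp (-(c * t)) = 1 / c ^ 2 := by
  have h1 := Real.integral_rpow_mul_exp_neg_mul_Ioi (a := 2) (r := c) (by norm_num) hc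
  have h2 : ∫ t in Set.Ioi (0 : ℝ), t * Real.exp (-(c * t)) = 1 / c ^ 2 := by
    norm_num at h1
    rw [h1]; norm_num
  refine ⟨?_, h2⟩
  by_contra h
  rw [integral_undef h] at h2
  have : 0 < 1 / c ^ 2 := by positivity
  linarith

/-- The lattice sum behind the constant of the sup-norm inequality. The summand is the integral of
`t * exp (-(a + |k|²) t)`, and the sum over `k` of `exp (-|k|² t)` is controlled by the theta
series. -/
lemma sum_inv_sq_le {F : Finset (Fin 2 → ℤ)} (hF : (0 : Fin 2 → ℤ) ∉ F) {a : ℝ} (ha : 0 < a) :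
    ∑ k ∈ F, 1 / (a + freqSq k) ^ 2 ≤ Real.pi / a := by
  have hpos : ∀ k, 0 < a + freqSq k := fun k => by linarith [freqSq_nonneg k]
  have hexp : IntegrableOn (fun t : ℝ => Real.pi * Real.exp (-a * t)) (Set.Ioi 0) :=
    (integrableOn_exp_mul_Ioi (by linarith) 0).const_mul _
  calc ∑ k ∈ F, 1 / (a + freqSq k) ^ 2
      = ∑ k ∈ F, ∫ t in Set.Ioi (0 : ℝ), t * Real.exp (-((a + freqSq k) * t)) :=
        Finset.sum_congr rfl fun k _ => (integrableOn_and_integral_mul_exp_neg (hpos k)).2.symm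
    _ = ∫ t in Set.Ioi (0 : ℝ), ∑ k ∈ F, t * Real.exp (-((a + freqSq k) * t)) :=
        (integral_finsetSum _ fun k _ => (integrableOn_and_integral_mul_exp_neg (hpos k)).1).symm
    _ ≤ ∫ t in Set.Ioi (0 : ℝ), Real.pi * Real.exp (-a * t) := by
        refine setIntegral_mono_on
          (integrable_finsetSum _ fun k _ => (integrableOn_and_integral_mul_exp_neg (hpos k)).1)
          hexp measurableSet_Ioi fun t ht => ?_
        have ht : 0 < t := ht
        have h1 : ∀ k, t * Real.exp (-((a + freqSq k) * t))
            = t * Real.exp (-a * t) * Real.exp (-(t * freqSq k)) := fun k => by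
          rw [mul_assoc, ← Real.exp_add]; ring_nf
        simp_rw [h1, ← Finset.mul_sum]
        calc _ ≤ t * Real.exp (-a * t) * (Real.pi / t) := by
              gcongr; exact sum_exp_neg_freqSq_le hF ht
          _ = _ := by field_simp
    _ = Real.pi / a := by
        rw [integral_const_mul, integral_exp_mul_Ioi (by linarith)]
        simp [div_eq_mul_inv]

/-! ### Calculus of smooth periodic functions on the cell -/

/-- Smooth functions on the plane that have period `L` in each variable, i.e. smooth functions on
the torus. -/
structure IsSmoothPeriodic (L : ℝ) (φ : ℝ × ℝ → ℝ) : Prop where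
  smooth : ContDiff ℝ ∞ φ
  periodic_x : ∀ x y, φ (x + L, y) = φ (x, y)
  periodic_y : ∀ x y, φ (x, y + L) = φ (x, y)

lemma hasDerivAt_fst {φ : ℝ × ℝ → ℝ} {p : ℝ × ℝ} (h : DifferentiableAt ℝ φ p) :
    HasDerivAt (fun s => φ (s, p.2)) (fderiv ℝ φ p (1, 0)) p.1 := by
  have h1 : HasDerivAt (fun s : ℝ => (s, p.2)) ((1 : ℝ), (0 : ℝ)) p.1 :=
    (hasDerivAt_id p.1).prodMk (hasDerivAt_const _ _)
  exact h.hasFDerivAt.comp_hasDerivAt p.1 h1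

lemma hasDerivAt_snd {φ : ℝ × ℝ → ℝ} {p : ℝ × ℝ} (h : DifferentiableAt ℝ φ p) :
    HasDerivAt (fun s => φ (p.1, s)) (fderiv ℝ φ p (0, 1)) p.2 := by
  have h1 : HasDerivAt (fun s : ℝ => (p.1, s)) ((0 : ℝ), (1 : ℝ)) p.2 :=
    (hasDerivAt_const _ _).prodMk (hasDerivAt_id p.2)
  exact h.hasFDerivAt.comp_hasDerivAt p.2 h1

lemma dx_eq_fderiv {φ : ℝ × ℝ → ℝ} {p : ℝ × ℝ} (h : DifferentiableAt ℝ φ p) :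
    dx φ p = fderiv ℝ φ p (1, 0) := (hasDerivAt_fst h).deriv

lemma dy_eq_fderiv {φ : ℝ × ℝ → ℝ} {p : ℝ × ℝ} (h : DifferentiableAt ℝ φ p) :
    dy φ p = fderiv ℝ φ p (0, 1) := (hasDerivAt_snd h).deriv

/-- Directional derivatives of a smooth function on an open set commute. -/
lemma fderiv_fderiv_apply_comm {E : Type*} [NormedAddCommGroup E] [NormedSpace ℝ E] {f : E → ℝ}
    {S : Set E} (hS : IsOpen S) (hf : ContDiffOn ℝ ∞ f S) {x : E} (hx : x ∈ S) (v w : E) :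
    fderiv ℝ (fun y => fderiv ℝ f y v) x w = fderiv ℝ (fun y => fderiv ℝ f y w) x v := by
  have hat : ContDiffAt ℝ ∞ f x := hf.contDiffAt (hS.mem_nhds hx)
  have hd : DifferentiableAt ℝ (fderiv ℝ f) x :=
    (hat.fderiv_right (m := ∞) (by simp)).differentiableAt (by simp)
  have h1 : ∀ v w, fderiv ℝ (fun y => fderiv ℝ f y v) x w = fderiv ℝ (fderiv ℝ f) x w v := by
    intro v w
    rw [fderiv_clm_apply hd (differentiableAt_const v)]
    simp
  rw [h1, h1]
  exact (hat.isSymmSndFDerivAt (by simpa using ENat.LEInfty.out)) w v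

lemma contDiffOn_fderiv_apply {E : Type*} [NormedAddCommGroup E] [NormedSpace ℝ E] {f : E → ℝ}
    {S : Set E} (hS : IsOpen S) (hf : ContDiffOn ℝ ∞ f S) (v : E) :
    ContDiffOn ℝ ∞ (fun y => fderiv ℝ f y v) S :=
  (hf.fderiv_of_isOpen hS (m := ∞) (by simp)).clm_apply contDiffOn_const

namespace IsSmoothPeriodic

variable {L : ℝ} {φ ψ : ℝ × ℝ → ℝ}

lemma differentiableAt (h : IsSmoothPeriodic L φ) (p : ℝ × ℝ) : DifferentiableAt ℝ φ p :=
  h.smooth.differentiable (by simp) p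

lemma continuous (h : IsSmoothPeriodic L φ) : Continuous φ := h.smooth.continuous

lemma dx (h : IsSmoothPeriodic L φ) : IsSmoothPeriodic L (dx φ) where
  smooth := by
    have : MKS.dx φ = fun p => fderiv ℝ φ p (1, 0) :=
      funext fun p => dx_eq_fderiv (h.differentiableAt p)
    rw [this, ← contDiffOn_univ]
    exact contDiffOn_fderiv_apply isOpen_univ h.smooth.contDiffOn _
  periodic_x x y := by
    simp only [MKS.dx]
    rw [← deriv_comp_add_const]
    simp only [h.periodic_x]
  periodic_y x y := by simp only [MKS.dx, h.periodic_y]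

lemma dy (h : IsSmoothPeriodic L φ) : IsSmoothPeriodic L (dy φ) where
  smooth := by
    have : MKS.dy φ = fun p => fderiv ℝ φ p (0, 1) :=
      funext fun p => dy_eq_fderiv (h.differentiableAt p)
    rw [this, ← contDiffOn_univ]
    exact contDiffOn_fderiv_apply isOpen_univ h.smooth.contDiffOn _
  periodic_x x y := by simp only [MKS.dy, h.periodic_x]
  periodic_y x y := by
    simp only [MKS.dy]
    rw [← deriv_comp_add_const]
    simp only [h.periodic_y]

lemma add (h : IsSmoothPeriodic L φ) (h' : IsSmoothPeriodic L ψ) :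
    IsSmoothPeriodic L (fun p => φ p + ψ p) where
  smooth := h.smooth.add h'.smooth
  periodic_x x y := by rw [h.periodic_x, h'.periodic_x]
  periodic_y x y := by rw [h.periodic_y, h'.periodic_y]

lemma sub (h : IsSmoothPeriodic L φ) (h' : IsSmoothPeriodic L ψ) :
    IsSmoothPeriodic L (fun p => φ p - ψ p) where
  smooth := h.smooth.sub h'.smooth
  periodic_x x y := by rw [h.periodic_x, h'.periodic_x]
  periodic_y x y := by rw [h.periodic_y, h'.periodic_y]

lemma mul (h : IsSmoothPeriodic L φ) (h' : IsSmoothPeriodic L ψ) :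
    IsSmoothPeriodic L (fun p => φ p * ψ p) where
  smooth := h.smooth.mul h'.smooth
  periodic_x x y := by rw [h.periodic_x, h'.periodic_x]
  periodic_y x y := by rw [h.periodic_y, h'.periodic_y]

lemma pow (h : IsSmoothPeriodic L φ) (n : ℕ) : IsSmoothPeriodic L (fun p => φ p ^ n) where
  smooth := h.smooth.pow n
  periodic_x x y := by rw [h.periodic_x]
  periodic_y x y := by rw [h.periodic_y]

lemma const (c : ℝ) : IsSmoothPeriodic L (fun _ => c) :=
  ⟨contDiff_const, fun _ _ => rfl, fun _ _ => rfl⟩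

lemma const_mul (h : IsSmoothPeriodic L φ) (c : ℝ) : IsSmoothPeriodic L (fun p => c * φ p) :=
  (const c).mul h

lemma lap (h : IsSmoothPeriodic L φ) : IsSmoothPeriodic L (lap φ) := h.dx.dx.add h.dy.dy

lemma hasDerivAt_dx (h : IsSmoothPeriodic L φ) (p : ℝ × ℝ) :
    HasDerivAt (fun s => φ (s, p.2)) (MKS.dx φ p) p.1 := by
  rw [dx_eq_fderiv (h.differentiableAt p)]
  exact hasDerivAt_fst (h.differentiableAt p)

lemma hasDerivAt_dy (h : IsSmoothPeriodic L φ) (p : ℝ × ℝ) :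
    HasDerivAt (fun s => φ (p.1, s)) (MKS.dy φ p) p.2 := by
  rw [dy_eq_fderiv (h.differentiableAt p)]
  exact hasDerivAt_snd (h.differentiableAt p)

lemma dx_add (h : IsSmoothPeriodic L φ) (h' : IsSmoothPeriodic L ψ) (p : ℝ × ℝ) :
    MKS.dx (fun p => φ p + ψ p) p = MKS.dx φ p + MKS.dx ψ p :=
  ((h.hasDerivAt_dx p).add (h'.hasDerivAt_dx p)).deriv

lemma dy_add (h : IsSmoothPeriodic L φ) (h' : IsSmoothPeriodic L ψ) (p : ℝ × ℝ) :
    MKS.dy (fun p => φ p + ψ p) p = MKS.dy φ p + MKS.dy ψ p :=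
  ((h.hasDerivAt_dy p).add (h'.hasDerivAt_dy p)).deriv

lemma dx_sub (h : IsSmoothPeriodic L φ) (h' : IsSmoothPeriodic L ψ) (p : ℝ × ℝ) :
    MKS.dx (fun p => φ p - ψ p) p = MKS.dx φ p - MKS.dx ψ p :=
  ((h.hasDerivAt_dx p).sub (h'.hasDerivAt_dx p)).deriv

lemma dy_sub (h : IsSmoothPeriodic L φ) (h' : IsSmoothPeriodic L ψ) (p : ℝ × ℝ) :
    MKS.dy (fun p => φ p - ψ p) p = MKS.dy φ p - MKS.dy ψ p :=
  ((h.hasDerivAt_dy p).sub (h'.hasDerivAt_dy p)).deriv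

lemma dx_mul (h : IsSmoothPeriodic L φ) (h' : IsSmoothPeriodic L ψ) (p : ℝ × ℝ) :
    MKS.dx (fun p => φ p * ψ p) p = MKS.dx φ p * ψ p + φ p * MKS.dx ψ p :=
  ((h.hasDerivAt_dx p).mul (h'.hasDerivAt_dx p)).deriv

lemma dy_mul (h : IsSmoothPeriodic L φ) (h' : IsSmoothPeriodic L ψ) (p : ℝ × ℝ) :
    MKS.dy (fun p => φ p * ψ p) p = MKS.dy φ p * ψ p + φ p * MKS.dy ψ p :=
  ((h.hasDerivAt_dy p).mul (h'.hasDerivAt_dy p)).deriv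

lemma dx_pow (h : IsSmoothPeriodic L φ) (n : ℕ) (p : ℝ × ℝ) :
    MKS.dx (fun p => φ p ^ n) p = n * φ p ^ (n - 1) * MKS.dx φ p :=
  ((h.hasDerivAt_dx p).pow n).deriv

lemma dy_pow (h : IsSmoothPeriodic L φ) (n : ℕ) (p : ℝ × ℝ) :
    MKS.dy (fun p => φ p ^ n) p = n * φ p ^ (n - 1) * MKS.dy φ p :=
  ((h.hasDerivAt_dy p).pow n).deriv

lemma dy_dx (h : IsSmoothPeriodic L φ) : MKS.dy (MKS.dx φ) = MKS.dx (MKS.dy φ) := by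
  funext p
  have h1 : MKS.dx φ = fun p => fderiv ℝ φ p (1, 0) :=
    funext fun p => dx_eq_fderiv (h.differentiableAt p)
  have h2 : MKS.dy φ = fun p => fderiv ℝ φ p (0, 1) :=
    funext fun p => dy_eq_fderiv (h.differentiableAt p)
  rw [dx_eq_fderiv (h.dy.differentiableAt p), dy_eq_fderiv (h.dx.differentiableAt p), h1, h2]
  exact fderiv_fderiv_apply_comm isOpen_univ h.smooth.contDiffOn (Set.mem_univ p) _ _

end IsSmoothPeriodic

lemma dx_const_mul (c : ℝ) (φ : ℝ × ℝ → ℝ) (p : ℝ × ℝ) :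
    dx (fun p => c * φ p) p = c * dx φ p := by simp [dx]

lemma dy_const_mul (c : ℝ) (φ : ℝ × ℝ → ℝ) (p : ℝ × ℝ) :
    dy (fun p => c * φ p) p = c * dy φ p := by simp [dy]

lemma isCompact_cell (L : ℝ) : IsCompact (cell L) := isCompact_Icc.prod isCompact_Icc

lemma measurableSet_cell (L : ℝ) : MeasurableSet (cell L) := (isCompact_cell L).measurableSet

lemma integrableOn_cell {φ : ℝ × ℝ → ℝ} (h : Continuous φ) (L : ℝ) : IntegrableOn φ (cell L) :=
  h.continuousOn.integrableOn_compact (isCompact_cell L)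

lemma volume_real_cell {L : ℝ} (hL : 0 ≤ L) : (volume : Measure (ℝ × ℝ)).real (cell L) = L ^ 2 := by
  rw [cell, Measure.real, Measure.volume_eq_prod, Measure.prod_prod, Real.volume_Icc, sub_zero,
    ENNReal.toReal_mul, ENNReal.toReal_ofReal hL, sq]

lemma integral_const_cell {L : ℝ} (hL : 0 ≤ L) (c : ℝ) : ∫ _p in cell L, c = L ^ 2 * c := by
  rw [setIntegral_const, volume_real_cell hL, smul_eq_mul]

lemma IsSmoothPeriodic.integral_dx {L : ℝ} (hL : 0 ≤ L) {φ : ℝ × ℝ → ℝ}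
    (h : IsSmoothPeriodic L φ) : ∫ p in cell L, MKS.dx φ p = 0 := by
  have hi := integrableOn_cell h.dx.continuous L
  rw [cell, Measure.volume_eq_prod] at hi ⊢
  rw [setIntegral_prod _ hi]
  have hi' : Integrable (Function.uncurry fun x y => MKS.dx φ (x, y))
      ((volume.restrict (Set.Icc 0 L)).prod (volume.restrict (Set.Icc 0 L))) := by
    rw [Measure.prod_restrict]; exact hi
  rw [integral_integral_swap hi']
  have : ∀ y, ∫ x in Set.Icc 0 L, MKS.dx φ (x, y) = 0 := by
    intro y
    rw [integral_Icc_eq_integral_Ioc, ← intervalIntegral.integral_of_le hL,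
      intervalIntegral.integral_eq_sub_of_hasDerivAt (f := fun s => φ (s, y))
        (fun x _ => h.hasDerivAt_dx (x, y))]
    · have := h.periodic_x 0 y
      rw [zero_add] at this
      simp [this]
    · exact (h.dx.continuous.comp (by fun_prop : Continuous fun x : ℝ => (x, y))).intervalIntegrable
        _ _
  simp [this]

lemma IsSmoothPeriodic.integral_dy {L : ℝ} (hL : 0 ≤ L) {φ : ℝ × ℝ → ℝ}
    (h : IsSmoothPeriodic L φ) : ∫ p in cell L, MKS.dy φ p = 0 := by
  have hi := integrableOn_cell h.dy.continuous L
  rw [cell, Measure.volume_eq_prod] at hi ⊢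
  rw [setIntegral_prod _ hi]
  have : ∀ x, ∫ y in Set.Icc 0 L, MKS.dy φ (x, y) = 0 := by
    intro x
    rw [integral_Icc_eq_integral_Ioc, ← intervalIntegral.integral_of_le hL,
      intervalIntegral.integral_eq_sub_of_hasDerivAt (f := fun s => φ (x, s))
        (fun y _ => h.hasDerivAt_dy (x, y))]
    · have := h.periodic_y x 0
      rw [zero_add] at this
      simp [this]
    · exact (h.dy.continuous.comp (by fun_prop : Continuous fun y : ℝ => (x, y))).intervalIntegrable
        _ _
  simp [this]

/-- Integration by parts on the torus, in the form in which it is used below: two functions that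
differ by a divergence have the same integral. -/
lemma integral_eq_of_sub_eq_div {L : ℝ} (hL : 0 ≤ L) {a b F G : ℝ × ℝ → ℝ} (ha : Continuous a)
    (hb : Continuous b) (hF : IsSmoothPeriodic L F) (hG : IsSmoothPeriodic L G)
    (h : ∀ p, a p - b p = dx F p + dy G p) : ∫ p in cell L, a p = ∫ p in cell L, b p := by
  rw [← sub_eq_zero, ← integral_sub (integrableOn_cell ha L) (integrableOn_cell hb L)]
  simp_rw [h]
  rw [integral_add (integrableOn_cell hF.dx.continuous L) (integrableOn_cell hG.dy.continuous L),
    hF.integral_dx hL, hG.integral_dy hL, add_zero]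

lemma integral_mul_sq_le {L : ℝ} {f g : ℝ × ℝ → ℝ} (hf : Continuous f) (hg : Continuous g) :
    (∫ p in cell L, f p * g p) ^ 2 ≤ (∫ p in cell L, f p ^ 2) * ∫ p in cell L, g p ^ 2 := by
  have key : ∀ x : ℝ, 0 ≤ (∫ p in cell L, g p ^ 2) * (x * x) + (2 * ∫ p in cell L, f p * g p) * x
      + ∫ p in cell L, f p ^ 2 := by
    intro x
    have : (∫ p in cell L, g p ^ 2) * (x * x) + (2 * ∫ p in cell L, f p * g p) * x
      + ∫ p in cell L, f p ^ 2 = ∫ p in cell L, (f p + x * g p) ^ 2 := by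
      have e : ∀ p, (f p + x * g p) ^ 2 = (x * x) * g p ^ 2 + (2 * x) * (f p * g p) + f p ^ 2 :=
        fun p => by ring
      simp_rw [e]
      rw [integral_add (integrableOn_cell (by fun_prop) L) (integrableOn_cell (by fun_prop) L),
        integral_add (integrableOn_cell (by fun_prop) L) (integrableOn_cell (by fun_prop) L),
        integral_const_mul, integral_const_mul]
      ring
    rw [this]
    exact integral_nonneg fun p => sq_nonneg _
  have := discrim_le_zero key
  rw [discrim] at this
  nlinarith

/-! ### The norms `J₀`, `J₁`, `J₂`, `J₃` as single integrals -/

section norms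

variable {L : ℝ} {φ : ℝ × ℝ → ℝ}

lemma J_nonneg (n : ℕ) : 0 ≤ J L n φ :=
  Finset.sum_nonneg fun _ _ => mul_nonneg (Nat.cast_nonneg _) (integral_nonneg fun _ => sq_nonneg _)

lemma J_zero : J L 0 φ = ∫ p in cell L, φ p ^ 2 := by
  simp [J, mixedDeriv]

lemma J_one (h : IsSmoothPeriodic L φ) : J L 1 φ = ∫ p in cell L, (dx φ p ^ 2 + dy φ p ^ 2) := by
  have hx := h.dx.continuous
  have hy := h.dy.continuous
  rw [integral_add (integrableOn_cell (by fun_prop) L) (integrableOn_cell (by fun_prop) L)]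
  simp [J, mixedDeriv, Finset.Nat.antidiagonal_succ]
  ring

lemma J_one_eq (hL : 0 ≤ L) (h : IsSmoothPeriodic L φ) :
    J L 1 φ = ∫ p in cell L, -(φ p * lap φ p) := by
  have hx := h.dx.continuous
  have hy := h.dy.continuous
  have h0 := h.continuous
  have hl := h.lap.continuous
  rw [J_one h]
  refine integral_eq_of_sub_eq_div hL (by fun_prop) (by fun_prop) (h.mul h.dx) (h.mul h.dy)
    fun p => ?_
  rw [h.dx_mul h.dx, h.dy_mul h.dy, lap]
  ring

lemma J_two (hL : 0 ≤ L) (h : IsSmoothPeriodic L φ) :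
    J L 2 φ = ∫ p in cell L, lap φ p ^ 2 := by
  have hx := h.dx.dx.continuous
  have hy := h.dy.dy.continuous
  have hxy := h.dy.dx.continuous
  have hl := h.lap.continuous
  have : J L 2 φ = ∫ p in cell L, (dx (dx φ) p ^ 2 + 2 * dx (dy φ) p ^ 2 + dy (dy φ) p ^ 2) := by
    rw [integral_add (integrableOn_cell (by fun_prop) L) (integrableOn_cell (by fun_prop) L),
      integral_add (integrableOn_cell (by fun_prop) L) (integrableOn_cell (by fun_prop) L),
      integral_const_mul]
    simp [J, mixedDeriv, Finset.Nat.antidiagonal_succ]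
    ring
  rw [this]
  refine integral_eq_of_sub_eq_div hL (by fun_prop) (by fun_prop)
    ((h.dx.mul h.dy.dy).const_mul (-2)) ((h.dx.mul h.dy.dx).const_mul 2) fun p => ?_
  rw [dx_const_mul, dy_const_mul, h.dx.dx_mul h.dy.dy, h.dx.dy_mul h.dy.dx, lap, h.dy_dx,
    h.dy.dy_dx]
  ring

lemma J_three (hL : 0 ≤ L) (h : IsSmoothPeriodic L φ) :
    J L 3 φ = ∫ p in cell L, (dx (lap φ) p ^ 2 + dy (lap φ) p ^ 2) := by
  have hxxx := h.dx.dx.dx.continuous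
  have hyyy := h.dy.dy.dy.continuous
  have hxxy := h.dy.dx.dx.continuous
  have hxyy := h.dy.dy.dx.continuous
  have hx := h.lap.dx.continuous
  have hy := h.lap.dy.continuous
  have : J L 3 φ = ∫ p in cell L, (dx (dx (dx φ)) p ^ 2 + 3 * dx (dx (dy φ)) p ^ 2
      + 3 * dx (dy (dy φ)) p ^ 2 + dy (dy (dy φ)) p ^ 2) := by
    rw [integral_add (integrableOn_cell (by fun_prop) L) (integrableOn_cell (by fun_prop) L),
      integral_add (integrableOn_cell (by fun_prop) L) (integrableOn_cell (by fun_prop) L),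
      integral_add (integrableOn_cell (by fun_prop) L) (integrableOn_cell (by fun_prop) L),
      integral_const_mul, integral_const_mul]
    simp [J, mixedDeriv, Finset.Nat.antidiagonal_succ]
    ring
  rw [this]
  refine integral_eq_of_sub_eq_div hL (by fun_prop) (by fun_prop)
    (((h.dx.dx.mul h.dy.dy.dx).add (h.dy.dx.mul h.dy.dy.dy)).const_mul (-2))
    (((h.dx.dx.mul h.dy.dx.dx).add (h.dy.dx.mul h.dy.dy.dx)).const_mul 2) fun p => ?_
  have ex : dx (lap φ) p = dx (dx (dx φ)) p + dx (dy (dy φ)) p := h.dx.dx.dx_add h.dy.dy p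
  have ey : dy (lap φ) p = dx (dx (dy φ)) p + dy (dy (dy φ)) p := by
    have := h.dx.dx.dy_add h.dy.dy p
    rw [h.dx.dy_dx, h.dy_dx] at this
    exact this
  rw [dx_const_mul, dy_const_mul,
    (h.dx.dx.mul h.dy.dy.dx).dx_add (h.dy.dx.mul h.dy.dy.dy),
    (h.dx.dx.mul h.dy.dx.dx).dy_add (h.dy.dx.mul h.dy.dy.dx), h.dx.dx.dx_mul h.dy.dy.dx,
    h.dy.dx.dx_mul h.dy.dy.dy, h.dx.dx.dy_mul h.dy.dx.dx, h.dy.dx.dy_mul h.dy.dy.dx, ex, ey,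
    h.dx.dy_dx, h.dy_dx, h.dy.dx.dy_dx, h.dy.dy_dx, h.dy.dy.dy_dx]
  ring

lemma J_one_sq_le (hL : 0 ≤ L) (h : IsSmoothPeriodic L φ) :
    J L 1 φ ^ 2 ≤ J L 2 φ * J L 0 φ := by
  rw [J_one_eq hL h, integral_neg, neg_sq, J_two hL h, J_zero, mul_comm]
  exact integral_mul_sq_le h.continuous h.lap.continuous

/-- Green's second identity on the torus. -/
lemma integral_mul_lap_comm (hL : 0 ≤ L) {ψ : ℝ × ℝ → ℝ} (h : IsSmoothPeriodic L φ)
    (h' : IsSmoothPeriodic L ψ) :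
    ∫ p in cell L, φ p * lap ψ p = ∫ p in cell L, lap φ p * ψ p := by
  have h1 := h.continuous
  have h2 := h'.continuous
  have h3 := h.lap.continuous
  have h4 := h'.lap.continuous
  refine integral_eq_of_sub_eq_div hL (by fun_prop) (by fun_prop)
    ((h.mul h'.dx).sub (h.dx.mul h')) ((h.mul h'.dy).sub (h.dy.mul h')) fun p => ?_
  rw [(h.mul h'.dx).dx_sub (h.dx.mul h'), (h.mul h'.dy).dy_sub (h.dy.mul h'), h.dx_mul h'.dx,
    h.dx.dx_mul h', h.dy_mul h'.dy, h.dy.dy_mul h', lap, lap]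
  ring

end norms

/-! ### Fourier series on the torus -/

/-- After rescaling, a function on the plane with period `L` in both variables factors through the
unit torus. -/
lemma IsSmoothPeriodic.exists_torus_lift {L : ℝ} {φ : ℝ × ℝ → ℝ} (h : IsSmoothPeriodic L φ) :
    ∃ f : C(UnitAddTorus (Fin 2), ℂ), ∀ x : Fin 2 → ℝ,
      f (fun i => (x i : UnitAddCircle)) = φ (L * x 0, L * x 1) := by
  have hq : IsOpenQuotientMap (fun (x : Fin 2 → ℝ) (i : Fin 2) => (x i : UnitAddCircle)) :=
    IsOpenQuotientMap.piMap fun _ => QuotientAddGroup.isOpenQuotientMap_mk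
  have hc := h.continuous
  set g : C(Fin 2 → ℝ, ℂ) := ⟨fun x => (φ (L * x 0, L * x 1) : ℂ), by fun_prop⟩ with hg
  have hfac : ∀ x y : Fin 2 → ℝ,
      (fun i => (x i : UnitAddCircle)) = (fun i => (y i : UnitAddCircle)) → g x = g y := by
    intro x y hxy
    have hint : ∀ i, ∃ n : ℤ, y i = x i + n := by
      intro i
      have := QuotientAddGroup.eq.1 (congrFun hxy i)
      obtain ⟨n, hn⟩ := AddSubgroup.mem_zmultiples_iff.1 this
      refine ⟨n, ?_⟩
      simp at hn
      linarith
    obtain ⟨n, hn⟩ := hint 0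
    obtain ⟨m, hm⟩ := hint 1
    have px : ∀ v, Function.Periodic (fun s => φ (s, v)) L := fun v s => h.periodic_x s v
    have py : ∀ s, Function.Periodic (fun v => φ (s, v)) L := fun s v => h.periodic_y s v
    simp only [hg, ContinuousMap.coe_mk, hn, hm, mul_add]
    rw [mul_comm L (n : ℝ), mul_comm L (m : ℝ)]
    have h1 := (px (L * x 1 + m * L)).int_mul n (L * x 0)
    have h2 := (py (L * x 0)).int_mul m (L * x 1)
    exact congrArg Complex.ofReal (h1.trans h2).symm
  set proj : C(Fin 2 → ℝ, UnitAddTorus (Fin 2)) :=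
    ⟨fun x i => (x i : UnitAddCircle), hq.continuous⟩
  have hproj : Topology.IsQuotientMap proj := hq.isQuotientMap
  have hF : Function.FactorsThrough g proj := fun x y hxy => hfac x y hxy
  exact ⟨hproj.lift g hF, fun x =>
    congrArg (fun F : C(Fin 2 → ℝ, ℂ) => F x) (hproj.lift_comp g hF)⟩

open scoped Pointwise in
lemma integral_unit_box {L : ℝ} (hL : 0 < L) {E : Type*} [NormedAddCommGroup E] [NormedSpace ℝ E]
    (g : ℝ × ℝ → E) :
    ∫ x : Fin 2 → ℝ in {x | ∀ i, x i ∈ Set.Ioc ((0 : Fin 2 → ℝ) i) ((0 : Fin 2 → ℝ) i + 1)},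
      g (L * x 0, L * x 1) = (L ^ 2)⁻¹ • ∫ p in cell L, g p := by
  have h1 : ∫ x : Fin 2 → ℝ in {x | ∀ i, x i ∈ Set.Ioc ((0 : Fin 2 → ℝ) i) ((0 : Fin 2 → ℝ) i + 1)},
      g (L * x 0, L * x 1) = ∫ p in Set.Ioc (0 : ℝ) 1 ×ˢ Set.Ioc (0 : ℝ) 1, g (L • p) := by
    rw [← (volume_preserving_finTwoArrow ℝ).setIntegral_preimage_emb
      (MeasurableEquiv.measurableEmbedding _)]
    congr 2
    ext x
    simp [Fin.forall_fin_two]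
  have h2 : L • (Set.Ioc (0 : ℝ) 1 ×ˢ Set.Ioc (0 : ℝ) 1) = Set.Ioc 0 L ×ˢ Set.Ioc 0 L := by
    ext p
    rw [Set.mem_smul_set_iff_inv_smul_mem₀ hL.ne']
    simp only [Set.mem_prod, Prod.smul_fst, Prod.smul_snd, smul_eq_mul, Set.mem_Ioc]
    have : ∀ s : ℝ, (0 < L⁻¹ * s ∧ L⁻¹ * s ≤ 1) ↔ (0 < s ∧ s ≤ L) := fun s => by
      rw [mul_pos_iff_of_pos_left (inv_pos.2 hL), inv_mul_le_iff₀ hL, mul_one]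
    rw [this, this]
  rw [h1, Measure.setIntegral_comp_smul_of_pos _ _ _ hL, h2]
  congr 1
  · simp
  · refine setIntegral_congr_set ?_
    rw [Measure.volume_eq_prod]
    exact Measure.set_prod_ae_eq Ioc_ae_eq_Icc Ioc_ae_eq_Icc

/-- The plane wave `cos (2π k·p / L + c)`; the phase `c` covers both the cosine and the sine. -/
noncomputable def wave (L : ℝ) (k : Fin 2 → ℤ) (c : ℝ) (p : ℝ × ℝ) : ℝ :=
  Real.cos (2 * Real.pi / L * k 0 * p.1 + 2 * Real.pi / L * k 1 * p.2 + c)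

lemma isSmoothPeriodic_wave {L : ℝ} (hL : 0 < L) (k : Fin 2 → ℤ) (c : ℝ) :
    IsSmoothPeriodic L (wave L k c) where
  smooth := by unfold wave; fun_prop
  periodic_x x y := by
    refine Eq.trans ?_ (Real.cos_add_int_mul_two_pi _ (k 0))
    rw [wave]
    congr 1; field_simp; ring
  periodic_y x y := by
    refine Eq.trans ?_ (Real.cos_add_int_mul_two_pi _ (k 1))
    rw [wave]
    congr 1; field_simp; ring

lemma deriv_deriv_cos_affine (a b s : ℝ) :
    deriv (fun s => deriv (fun s => Real.cos (a * s + b)) s) s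
      = -(a ^ 2 * Real.cos (a * s + b)) := by
  have ha : ∀ s, HasDerivAt (fun s => a * s + b) a s := fun s => by
    simpa using ((hasDerivAt_id s).const_mul a).add_const b
  have h1 : (fun s => deriv (fun s => Real.cos (a * s + b)) s)
      = fun s => -Real.sin (a * s + b) * a := funext fun s => (ha s).cos.deriv
  rw [h1, (((ha s).sin.fun_neg).mul_const a).deriv]
  ring

lemma lap_wave (L : ℝ) (k : Fin 2 → ℤ) (c : ℝ) (p : ℝ × ℝ) :
    lap (wave L k c) p = -((2 * Real.pi / L) ^ 2 * freqSq k) * wave L k c p := by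
  have h1 : dx (dx (wave L k c)) p = -((2 * Real.pi / L * k 0) ^ 2 * wave L k c p) := by
    have := deriv_deriv_cos_affine (2 * Real.pi / L * k 0) (2 * Real.pi / L * k 1 * p.2 + c) p.1
    simpa only [dx, wave, add_assoc] using this
  have h2 : dy (dy (wave L k c)) p = -((2 * Real.pi / L * k 1) ^ 2 * wave L k c p) := by
    have := deriv_deriv_cos_affine (2 * Real.pi / L * k 1) (2 * Real.pi / L * k 0 * p.1 + c) p.2
    have e : ∀ s : ℝ, 2 * Real.pi / L * k 1 * s + (2 * Real.pi / L * k 0 * p.1 + c)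
      = 2 * Real.pi / L * k 0 * p.1 + 2 * Real.pi / L * k 1 * s + c := fun s => by ring
    simp only [e] at this
    simpa only [dy, wave] using this
  rw [lap, h1, h2, freqSq]
  ring

/-- The Fourier coefficients of an `L`-periodic function, on the frequencies `2π k / L`. -/
noncomputable def coeff (L : ℝ) (φ : ℝ × ℝ → ℝ) (k : Fin 2 → ℤ) : ℂ :=
  ((L ^ 2)⁻¹ : ℝ) * ((∫ p in cell L, φ p * wave L k 0 p : ℝ)
    - (∫ p in cell L, φ p * wave L k (-(Real.pi / 2)) p : ℝ) * Complex.I)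

section coeff

variable {L : ℝ} {φ : ℝ × ℝ → ℝ}

lemma coeff_lap (hL : 0 < L) (h : IsSmoothPeriodic L φ) (k : Fin 2 → ℤ) :
    coeff L (lap φ) k = -((2 * Real.pi / L) ^ 2 * freqSq k : ℝ) * coeff L φ k := by
  have key : ∀ c, ∫ p in cell L, lap φ p * wave L k c p
      = -((2 * Real.pi / L) ^ 2 * freqSq k) * ∫ p in cell L, φ p * wave L k c p := by
    intro c
    rw [← integral_mul_lap_comm hL.le h (isSmoothPeriodic_wave hL k c), ← integral_const_mul]
    congr 1
    funext p
    rw [lap_wave]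
    ring
  rw [coeff, coeff, key, key]
  push_cast
  ring

lemma mFourierCoeff_eq_coeff (hL : 0 < L) (h : IsSmoothPeriodic L φ)
    {f : C(UnitAddTorus (Fin 2), ℂ)}
    (hf : ∀ x : Fin 2 → ℝ, f (fun i => (x i : UnitAddCircle)) = φ (L * x 0, L * x 1))
    (k : Fin 2 → ℤ) : UnitAddTorus.mFourierCoeff f k = coeff L φ k := by
  rw [UnitAddTorus.mFourierCoeff_eq_integral f k 0]
  set g : ℝ × ℝ → ℂ := fun p => ((φ p * wave L k 0 p : ℝ) : ℂ)
    - ((φ p * wave L k (-(Real.pi / 2)) p : ℝ) : ℂ) * Complex.I with hg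
  have hpt : ∀ x : Fin 2 → ℝ, UnitAddTorus.mFourier (-k) (fun i => (x i : UnitAddCircle)) •
      f (fun i => (x i : UnitAddCircle)) = g (L * x 0, L * x 1) := by
    intro x
    have e1 : UnitAddTorus.mFourier (-k) (fun i => (x i : UnitAddCircle))
        = Complex.exp (-((2 * Real.pi * (k 0 * x 0 + k 1 * x 1) : ℝ) : ℂ) * Complex.I) := by
      simp only [UnitAddTorus.mFourier, ContinuousMap.coe_mk, Fin.prod_univ_two, fourier_coe_apply,
        ← Complex.exp_add]
      congr 1
      simp
      ring
    have e2 : ∀ c, wave L k c (L * x 0, L * x 1)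
        = Real.cos (2 * Real.pi * (k 0 * x 0 + k 1 * x 1) + c) := by
      intro c
      rw [wave]
      congr 1
      field_simp
    rw [hf, e1, smul_eq_mul]
    simp only [hg, e2]
    rw [← sub_eq_add_neg, Real.cos_sub_pi_div_two, add_zero, Complex.exp_mul_I, Complex.cos_neg,
      Complex.sin_neg]
    push_cast
    ring
  simp_rw [hpt]
  rw [integral_unit_box hL, hg, integral_sub, integral_mul_const, integral_complex_ofReal,
    integral_complex_ofReal, coeff]
  · simp
  · exact (integrableOn_cell (h.mul (isSmoothPeriodic_wave hL k 0)).continuous L).ofReal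
  · exact ((integrableOn_cell (h.mul (isSmoothPeriodic_wave hL k _)).continuous L).ofReal).mul_const _

attribute [local instance] instMeasureSpaceUnitAddCircle
attribute [local instance] instIsProbabilityMeasureUnitAddCircleVolume

/-- Parseval's identity on the torus. -/
lemma hasSum_norm_coeff_sq (hL : 0 < L) (h : IsSmoothPeriodic L φ) :
    HasSum (fun k => ‖coeff L φ k‖ ^ 2) ((L ^ 2)⁻¹ * J L 0 φ) := by
  obtain ⟨f, hf⟩ := h.exists_torus_lift
  have h1 := UnitAddTorus.hasSum_sq_mFourierCoeff (ContinuousMap.toLp (E := ℂ) 2 _ ℂ f)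
  simp only [UnitAddTorus.mFourierCoeff_toLp, mFourierCoeff_eq_coeff hL h hf] at h1
  convert h1 using 1
  rw [integral_congr_ae ((ContinuousMap.coeFn_toLp _ f).mono fun t ht => by
    show _ = ‖f t‖ ^ 2
    rw [ht])]
  rw [UnitAddTorus.integral_preimage (fun t => ‖f t‖ ^ 2) 0]
  have := integral_unit_box hL (fun p => φ p ^ 2)
  rw [J_zero, ← smul_eq_mul, ← this]
  congr 1
  funext x
  rw [hf]
  simp

lemma abs_le_of_sum_norm_coeff_le (hL : 0 < L) (h : IsSmoothPeriodic L φ) {M : ℝ}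
    (hM : ∀ F : Finset (Fin 2 → ℤ), ∑ k ∈ F, ‖coeff L φ k‖ ≤ M) (p : ℝ × ℝ) : |φ p| ≤ M := by
  obtain ⟨f, hf⟩ := h.exists_torus_lift
  have hs : Summable fun k => ‖coeff L φ k‖ := summable_of_sum_le (fun _ => norm_nonneg _) hM
  have hc : UnitAddTorus.mFourierCoeff f = coeff L φ := funext (mFourierCoeff_eq_coeff hL h hf)
  have h1 := UnitAddTorus.hasSum_mFourier_series_apply_of_summable (f := f)
    (by rw [hc]; exact hs.of_norm) (fun i => ((![p.1 / L, p.2 / L] i : ℝ) : UnitAddCircle))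
  rw [hf, hc] at h1
  have hp : ((L * ![p.1 / L, p.2 / L] 0, L * ![p.1 / L, p.2 / L] 1) : ℝ × ℝ) = p := by
    ext <;> simp <;> field_simp
  rw [hp] at h1
  have hb : ∀ k, ‖coeff L φ k • UnitAddTorus.mFourier k
      (fun i => ((![p.1 / L, p.2 / L] i : ℝ) : UnitAddCircle))‖ ≤ ‖coeff L φ k‖ := by
    intro k
    rw [norm_smul]
    refine mul_le_of_le_one_right (norm_nonneg _) ?_
    exact ((UnitAddTorus.mFourier k).norm_coe_le_norm _).trans UnitAddTorus.mFourier_norm.le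
  have h2 := tsum_of_norm_bounded hs.hasSum hb
  rw [h1.tsum_eq, Complex.norm_real, Real.norm_eq_abs] at h2
  exact h2.trans (hs.tsum_le_of_sum_le hM)

end coeff

/-! ### The sup-norm inequality -/

/-- The optimal parameter is `a = q / p`; when `p` or `q` vanishes, the infimum over `a` is zero. -/
lemma le_four_mul_of_forall_le {X p q c : ℝ} (hp : 0 ≤ p) (hq : 0 ≤ q) (hc : 0 < c)
    (h : ∀ a > 0, X ≤ c / a * (a * p + q) ^ 2) : X ≤ 4 * c * p * q := by
  rcases hp.eq_or_lt with rfl | hp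
  · by_contra! hX
    have hX : 0 < X := by linarith
    have := h (c * (q ^ 2 + 1) * 2 / X) (by positivity)
    have e : c / (c * (q ^ 2 + 1) * 2 / X) * (c * (q ^ 2 + 1) * 2 / X * 0 + q) ^ 2
      = X * (q ^ 2 / (2 * (q ^ 2 + 1))) := by field_simp; ring
    rw [e] at this
    have : q ^ 2 / (2 * (q ^ 2 + 1)) < 1 := by rw [div_lt_one (by positivity)]; nlinarith
    nlinarith
  rcases hq.eq_or_lt with rfl | hq
  · by_contra! hX
    have hX : 0 < X := by linarith
    have := h (X / (2 * c * p ^ 2)) (by positivity)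
    have e : c / (X / (2 * c * p ^ 2)) * (X / (2 * c * p ^ 2) * p + 0) ^ 2 = X / 2 := by
      rw [add_zero]; field_simp
    linarith
  · have := h (q / p) (by positivity)
    have e : c / (q / p) * (q / p * p + q) ^ 2 = 4 * c * p * q := by field_simp; ring
    linarith

section agmon

variable {L : ℝ} {φ : ℝ × ℝ → ℝ}

/-- The Fourier series of a mean-zero function is absolutely summable, by the Cauchy–Schwarz
inequality with the weights `a + |k|²`. The parameter `a` is free. -/
lemma sum_norm_coeff_sq_le (hL : 0 < L) (h : IsSmoothPeriodic L φ) (h0 : coeff L φ 0 = 0) {a : ℝ}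
    (ha : 0 < a) (F : Finset (Fin 2 → ℤ)) :
    (∑ k ∈ F, ‖coeff L φ k‖) ^ 2 ≤ Real.pi / a *
      (a * √((L ^ 2)⁻¹ * J L 0 φ) + √((L ^ 2)⁻¹ * J L 0 (lap φ)) / (2 * Real.pi / L) ^ 2) ^ 2 := by
  classical
  have hpi := Real.pi_pos
  set w := (2 * Real.pi / L) ^ 2 with hw
  have hw0 : 0 < w := by positivity
  set A := (L ^ 2)⁻¹ * J L 0 φ
  set B := (L ^ 2)⁻¹ * J L 0 (lap φ)
  have hA0 : 0 ≤ A := mul_nonneg (by positivity) (J_nonneg _)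
  have hB0 : 0 ≤ B := mul_nonneg (by positivity) (J_nonneg _)
  have hsum : ∑ k ∈ F, ‖coeff L φ k‖ = ∑ k ∈ F.erase 0, ‖coeff L φ k‖ := by
    refine (Finset.sum_subset (Finset.erase_subset 0 F) fun k hk hk' => ?_).symm
    have : k = 0 := by
      by_contra hne
      exact hk' (Finset.mem_erase.2 ⟨hne, hk⟩)
    rw [this, h0, norm_zero]
  set G := F.erase 0
  have hr : ∀ k, 0 < a + freqSq k := fun k => by linarith [freqSq_nonneg k]
  have hA : ∑ k ∈ G, ‖coeff L φ k‖ ^ 2 ≤ A :=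
    sum_le_hasSum G (fun _ _ => sq_nonneg _) (hasSum_norm_coeff_sq hL h)
  have hB : ∑ k ∈ G, (freqSq k * ‖coeff L φ k‖) ^ 2 ≤ B / w ^ 2 := by
    have := sum_le_hasSum G (fun _ _ => sq_nonneg _) (hasSum_norm_coeff_sq hL h.lap)
    rw [le_div_iff₀ (by positivity), Finset.sum_mul]
    refine le_of_eq_of_le (Finset.sum_congr rfl fun k _ => ?_) this
    rw [coeff_lap hL h, norm_mul, norm_neg, Complex.norm_real, Real.norm_eq_abs, mul_pow, mul_pow,
      sq_abs, ← hw]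
    ring
  have hAB : ∑ k ∈ G, ‖coeff L φ k‖ * (freqSq k * ‖coeff L φ k‖) ≤ √A * (√B / w) := by
    have hCS := Finset.sum_mul_sq_le_sq_mul_sq G (fun k => ‖coeff L φ k‖)
      (fun k => freqSq k * ‖coeff L φ k‖)
    refine abs_le_of_sq_le_sq' ?_ (by positivity) |>.2
    calc _ ≤ _ := hCS
      _ ≤ A * (B / w ^ 2) := by
        gcongr
      _ = _ := by rw [mul_pow, div_pow, Real.sq_sqrt hA0, Real.sq_sqrt hB0]
  have hW : ∑ k ∈ G, ((a + freqSq k) * ‖coeff L φ k‖) ^ 2 ≤ (a * √A + √B / w) ^ 2 := by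
    have e : ∀ k, ((a + freqSq k) * ‖coeff L φ k‖) ^ 2 = a ^ 2 * ‖coeff L φ k‖ ^ 2
        + 2 * a * (‖coeff L φ k‖ * (freqSq k * ‖coeff L φ k‖)) + (freqSq k * ‖coeff L φ k‖) ^ 2 :=
      fun k => by ring
    simp_rw [e]
    rw [Finset.sum_add_distrib, Finset.sum_add_distrib, ← Finset.mul_sum, ← Finset.mul_sum]
    have e2 : (a * √A + √B / w) ^ 2 = a ^ 2 * A + 2 * a * (√A * (√B / w)) + B / w ^ 2 := by
      rw [add_sq, mul_pow, div_pow, Real.sq_sqrt hA0, Real.sq_sqrt hB0]; ring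
    rw [e2]
    gcongr
  have hg : ∑ k ∈ G, (1 / (a + freqSq k)) ^ 2 ≤ Real.pi / a := by
    simpa only [div_pow, one_pow] using sum_inv_sq_le (Finset.notMem_erase 0 F) ha
  rw [hsum]
  calc (∑ k ∈ G, ‖coeff L φ k‖) ^ 2
      = (∑ k ∈ G, (1 / (a + freqSq k)) * ((a + freqSq k) * ‖coeff L φ k‖)) ^ 2 := by
        congr 1
        refine Finset.sum_congr rfl fun k _ => ?_
        have := (hr k).ne'
        field_simp
    _ ≤ _ := Finset.sum_mul_sq_le_sq_mul_sq _ _ _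
    _ ≤ _ := by
        gcongr

lemma mean_sq_le (hL : 0 < L) (h : Continuous φ) : L ^ 2 * mean L φ ^ 2 ≤ J L 0 φ := by
  have h1 := integral_mul_sq_le (L := L) h (continuous_const (y := (1 : ℝ)))
  simp only [mul_one, one_pow] at h1
  rw [integral_const_cell hL.le, ← J_zero] at h1
  rw [mean, div_pow, ← mul_div_assoc, div_le_iff₀ (by positivity)]
  nlinarith [sq_nonneg L]

lemma isSmoothPeriodic_fluct (h : IsSmoothPeriodic L φ) : IsSmoothPeriodic L (fluct L φ) :=
  h.sub (.const _)

lemma dx_fluct (p : ℝ × ℝ) : dx (fluct L φ) p = dx φ p := by simp [dx, fluct]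

lemma dy_fluct (p : ℝ × ℝ) : dy (fluct L φ) p = dy φ p := by simp [dy, fluct]

lemma lap_fluct : lap (fluct L φ) = lap φ := by
  have h1 : dx (fluct L φ) = dx φ := funext dx_fluct
  have h2 : dy (fluct L φ) = dy φ := funext dy_fluct
  unfold lap
  rw [h1, h2]

lemma integral_fluct (hL : 0 < L) (h : Continuous φ) : ∫ p in cell L, fluct L φ p = 0 := by
  unfold fluct
  rw [integral_sub (integrableOn_cell h L) (integrableOn_cell continuous_const L),
    integral_const_cell hL.le, mean]
  field_simp
  ring

lemma J_zero_fluct_le (hL : 0 < L) (h : Continuous φ) : J L 0 (fluct L φ) ≤ J L 0 φ := by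
  have h1 : ∀ p, fluct L φ p ^ 2 = φ p ^ 2 - (2 * mean L φ * φ p - mean L φ ^ 2) := fun p => by
    rw [fluct]; ring
  have h2 : ∫ p in cell L, φ p = L ^ 2 * mean L φ := by rw [mean]; field_simp
  rw [J_zero, J_zero]
  simp_rw [h1]
  rw [integral_sub (integrableOn_cell (by fun_prop) L) (integrableOn_cell (by fun_prop) L),
    integral_sub (integrableOn_cell (by fun_prop) L) (integrableOn_cell (by fun_prop) L),
    integral_const_mul, integral_const_cell hL.le, h2]
  nlinarith [mul_nonneg (sq_nonneg L) (sq_nonneg (mean L φ))]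

/-- Agmon's inequality on the torus, with the constant `π ^ (-1/2)`. -/
theorem fluct_sq_le (hL : 0 < L) (h : IsSmoothPeriodic L φ) (p : ℝ × ℝ) :
    fluct L φ p ^ 2 ≤ √(J L 0 φ * J L 2 φ) / Real.pi := by
  have hpi := Real.pi_pos
  have h' := isSmoothPeriodic_fluct h
  have hc0 : coeff L (fluct L φ) 0 = 0 := by
    simp [coeff, wave, integral_fluct hL h.continuous]
  have key := le_four_mul_of_forall_le (X := fluct L φ p ^ 2)
    (p := √((L ^ 2)⁻¹ * J L 0 (fluct L φ)))
    (q := √((L ^ 2)⁻¹ * J L 0 (lap (fluct L φ))) / (2 * Real.pi / L) ^ 2) (Real.sqrt_nonneg _)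
    (by positivity) hpi fun a ha => by
      have := abs_le_of_sum_norm_coeff_le hL h'
        (fun F => Real.le_sqrt_of_sq_le (sum_norm_coeff_sq_le hL h' hc0 ha F)) p
      rw [← sq_abs]
      calc _ ≤ _ := pow_le_pow_left₀ (abs_nonneg _) this 2
        _ = _ := Real.sq_sqrt (by positivity)
  refine key.trans ?_
  have hJ2 : J L 0 (lap (fluct L φ)) = J L 2 φ := by rw [lap_fluct, J_two hL.le h, J_zero]
  rw [hJ2, Real.sqrt_mul (by positivity), Real.sqrt_mul (by positivity),
    Real.sqrt_mul (J_nonneg _), Real.sqrt_inv, Real.sqrt_sq hL.le]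
  calc _ = √(J L 0 (fluct L φ)) * √(J L 2 φ) / Real.pi := by field_simp; ring
    _ ≤ _ := by
      gcongr
      exact J_zero_fluct_le hL h.continuous

end agmon

/-! ### Smooth families of periodic functions -/

/-- A family `U t`, `0 < t`, of `L`-periodic functions that is jointly smooth in time and space. -/
structure IsSmoothFamily (L : ℝ) (U : ℝ → ℝ × ℝ → ℝ) : Prop where
  smooth : ContDiffOn ℝ ∞ (Function.uncurry U) (Set.Ioi (0 : ℝ) ×ˢ Set.univ)
  periodic_x : ∀ t > 0, ∀ x y, U t (x + L, y) = U t (x, y)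
  periodic_y : ∀ t > 0, ∀ x y, U t (x, y + L) = U t (x, y)

/-- The time derivative of a family of functions of space. -/
noncomputable def dt (U : ℝ → ℝ × ℝ → ℝ) : ℝ → ℝ × ℝ → ℝ := fun t p => deriv (fun s => U s p) t

lemma isOpen_timeSpace : IsOpen (Set.Ioi (0 : ℝ) ×ˢ (Set.univ : Set (ℝ × ℝ))) :=
  isOpen_Ioi.prod isOpen_univ

lemma mem_timeSpace {t : ℝ} (ht : 0 < t) (p : ℝ × ℝ) :
    (t, p) ∈ Set.Ioi (0 : ℝ) ×ˢ (Set.univ : Set (ℝ × ℝ)) := ⟨ht, Set.mem_univ p⟩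

namespace IsSmoothFamily

variable {L : ℝ} {U V : ℝ → ℝ × ℝ → ℝ} {t : ℝ}

lemma contDiffAt (h : IsSmoothFamily L U) (ht : 0 < t) (p : ℝ × ℝ) :
    ContDiffAt ℝ ∞ (Function.uncurry U) (t, p) :=
  h.smooth.contDiffAt (isOpen_timeSpace.mem_nhds (mem_timeSpace ht p))

lemma slice (h : IsSmoothFamily L U) (ht : 0 < t) : IsSmoothPeriodic L (U t) where
  smooth := contDiff_iff_contDiffAt.2 fun p =>
    (h.contDiffAt ht p).comp p (contDiffAt_const.prodMk contDiffAt_id)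
  periodic_x := h.periodic_x t ht
  periodic_y := h.periodic_y t ht

lemma hasDerivAt_dt (h : IsSmoothFamily L U) (ht : 0 < t) (p : ℝ × ℝ) :
    HasDerivAt (fun s => U s p) (dt U t p) t := by
  have h1 : HasDerivAt (fun s : ℝ => (s, p)) ((1 : ℝ), (0 : ℝ × ℝ)) t :=
    (hasDerivAt_id t).prodMk (hasDerivAt_const _ _)
  have := ((h.contDiffAt ht p).differentiableAt (by simp)).hasFDerivAt.comp_hasDerivAt t h1
  exact this.differentiableAt.hasDerivAt

lemma dt_eq (h : IsSmoothFamily L U) (ht : 0 < t) (p : ℝ × ℝ) :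
    dt U t p = fderiv ℝ (Function.uncurry U) (t, p) (1, 0) := by
  have h1 : HasDerivAt (fun s : ℝ => (s, p)) ((1 : ℝ), (0 : ℝ × ℝ)) t :=
    (hasDerivAt_id t).prodMk (hasDerivAt_const _ _)
  exact (((h.contDiffAt ht p).differentiableAt (by simp)).hasFDerivAt.comp_hasDerivAt t h1).deriv

lemma dx_eq (h : IsSmoothFamily L U) (ht : 0 < t) (p : ℝ × ℝ) :
    MKS.dx (U t) p = fderiv ℝ (Function.uncurry U) (t, p) (0, (1, 0)) := by
  have h1 : HasDerivAt (fun s : ℝ => (t, (s, p.2))) ((0 : ℝ), ((1 : ℝ), (0 : ℝ))) p.1 :=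
    (hasDerivAt_const _ _).prodMk ((hasDerivAt_id p.1).prodMk (hasDerivAt_const _ _))
  exact (((h.contDiffAt ht p).differentiableAt (by simp)).hasFDerivAt.comp_hasDerivAt p.1 h1).deriv

lemma dy_eq (h : IsSmoothFamily L U) (ht : 0 < t) (p : ℝ × ℝ) :
    MKS.dy (U t) p = fderiv ℝ (Function.uncurry U) (t, p) (0, (0, 1)) := by
  have h1 : HasDerivAt (fun s : ℝ => (t, (p.1, s))) ((0 : ℝ), ((0 : ℝ), (1 : ℝ))) p.2 :=
    (hasDerivAt_const _ _).prodMk ((hasDerivAt_const _ _).prodMk (hasDerivAt_id p.2))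
  exact (((h.contDiffAt ht p).differentiableAt (by simp)).hasFDerivAt.comp_hasDerivAt p.2 h1).deriv

lemma eqOn_dx (h : IsSmoothFamily L U) : Set.EqOn (Function.uncurry fun t => MKS.dx (U t))
    (fun q => fderiv ℝ (Function.uncurry U) q (0, (1, 0))) (Set.Ioi (0 : ℝ) ×ˢ Set.univ) :=
  fun q hq => h.dx_eq hq.1 q.2

lemma eqOn_dy (h : IsSmoothFamily L U) : Set.EqOn (Function.uncurry fun t => MKS.dy (U t))
    (fun q => fderiv ℝ (Function.uncurry U) q (0, (0, 1))) (Set.Ioi (0 : ℝ) ×ˢ Set.univ) :=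
  fun q hq => h.dy_eq hq.1 q.2

lemma eqOn_dt (h : IsSmoothFamily L U) : Set.EqOn (Function.uncurry (dt U))
    (fun q => fderiv ℝ (Function.uncurry U) q (1, 0)) (Set.Ioi (0 : ℝ) ×ˢ Set.univ) :=
  fun q hq => h.dt_eq hq.1 q.2

lemma dx (h : IsSmoothFamily L U) : IsSmoothFamily L (fun t => MKS.dx (U t)) where
  smooth := (contDiffOn_fderiv_apply isOpen_timeSpace h.smooth _).congr h.eqOn_dx
  periodic_x _ ht := (h.slice ht).dx.periodic_x
  periodic_y _ ht := (h.slice ht).dx.periodic_y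

lemma dy (h : IsSmoothFamily L U) : IsSmoothFamily L (fun t => MKS.dy (U t)) where
  smooth := (contDiffOn_fderiv_apply isOpen_timeSpace h.smooth _).congr h.eqOn_dy
  periodic_x _ ht := (h.slice ht).dy.periodic_x
  periodic_y _ ht := (h.slice ht).dy.periodic_y

lemma time_deriv (h : IsSmoothFamily L U) : IsSmoothFamily L (dt U) where
  smooth := (contDiffOn_fderiv_apply isOpen_timeSpace h.smooth _).congr h.eqOn_dt
  periodic_x _ ht x y :=
    Filter.EventuallyEq.deriv_eq ((eventually_gt_nhds ht).mono fun s hs => h.periodic_x s hs x y)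
  periodic_y _ ht x y :=
    Filter.EventuallyEq.deriv_eq ((eventually_gt_nhds ht).mono fun s hs => h.periodic_y s hs x y)

lemma add (h : IsSmoothFamily L U) (h' : IsSmoothFamily L V) :
    IsSmoothFamily L (fun t p => U t p + V t p) where
  smooth := h.smooth.add h'.smooth
  periodic_x t ht x y := by rw [h.periodic_x t ht, h'.periodic_x t ht]
  periodic_y t ht x y := by rw [h.periodic_y t ht, h'.periodic_y t ht]

lemma sq (h : IsSmoothFamily L U) : IsSmoothFamily L (fun t p => U t p ^ 2) where
  smooth := h.smooth.pow 2
  periodic_x t ht x y := by rw [h.periodic_x t ht]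
  periodic_y t ht x y := by rw [h.periodic_y t ht]

lemma iterate_dx (h : IsSmoothFamily L U) (n : ℕ) :
    IsSmoothFamily L (fun t => MKS.dx^[n] (U t)) := by
  induction n with
  | zero => exact h
  | succ n ih => simp only [Function.iterate_succ_apply']; exact ih.dx

lemma iterate_dy (h : IsSmoothFamily L U) (n : ℕ) :
    IsSmoothFamily L (fun t => MKS.dy^[n] (U t)) := by
  induction n with
  | zero => exact h
  | succ n ih => simp only [Function.iterate_succ_apply']; exact ih.dy

lemma mixedDeriv (h : IsSmoothFamily L U) (m n : ℕ) :
    IsSmoothFamily L (fun t => mixedDeriv m n (U t)) := (h.iterate_dy n).iterate_dx m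

lemma dt_dx (h : IsSmoothFamily L U) (ht : 0 < t) (p : ℝ × ℝ) :
    dt (fun t => MKS.dx (U t)) t p = MKS.dx (dt U t) p := by
  have hmem := isOpen_timeSpace.mem_nhds (mem_timeSpace ht p)
  rw [h.dx.dt_eq ht, h.time_deriv.dx_eq ht, (h.eqOn_dx.eventuallyEq_of_mem hmem).fderiv_eq,
    (h.eqOn_dt.eventuallyEq_of_mem hmem).fderiv_eq]
  exact fderiv_fderiv_apply_comm isOpen_timeSpace h.smooth (mem_timeSpace ht p) _ _

lemma dt_dy (h : IsSmoothFamily L U) (ht : 0 < t) (p : ℝ × ℝ) :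
    dt (fun t => MKS.dy (U t)) t p = MKS.dy (dt U t) p := by
  have hmem := isOpen_timeSpace.mem_nhds (mem_timeSpace ht p)
  rw [h.dy.dt_eq ht, h.time_deriv.dy_eq ht, (h.eqOn_dy.eventuallyEq_of_mem hmem).fderiv_eq,
    (h.eqOn_dt.eventuallyEq_of_mem hmem).fderiv_eq]
  exact fderiv_fderiv_apply_comm isOpen_timeSpace h.smooth (mem_timeSpace ht p) _ _

lemma hasDerivAt_integral (h : IsSmoothFamily L U) (ht : 0 < t) :
    HasDerivAt (fun s => ∫ p in cell L, U s p) (∫ p in cell L, dt U t p) t := by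
  have hK : IsCompact (Set.Icc (t / 2) (2 * t) ×ˢ cell L) := isCompact_Icc.prod (isCompact_cell L)
  have hsub : Set.Icc (t / 2) (2 * t) ×ˢ cell L ⊆ Set.Ioi (0 : ℝ) ×ˢ (Set.univ : Set (ℝ × ℝ)) :=
    fun q hq => ⟨lt_of_lt_of_le (by positivity) hq.1.1, Set.mem_univ _⟩
  obtain ⟨M, hM⟩ := hK.exists_bound_of_continuousOn (h.time_deriv.smooth.continuousOn.mono hsub)
  refine (hasDerivAt_integral_of_dominated_loc_of_deriv_le (μ := volume.restrict (cell L))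
    (s := Set.Icc (t / 2) (2 * t)) (F' := fun s p => dt U s p) (bound := fun _ => M)
    (Icc_mem_nhds (by linarith) (by linarith)) ?_ ?_ ?_ ?_ ?_ ?_).2
  · filter_upwards [eventually_gt_nhds ht] with s hs
    exact (h.slice hs).continuous.aestronglyMeasurable
  · exact integrableOn_cell (h.slice ht).continuous L
  · exact (h.time_deriv.slice ht).continuous.aestronglyMeasurable
  · refine (ae_restrict_mem (measurableSet_cell L)).mono fun p hp s hs => hM (s, p) ⟨hs, hp⟩
  · exact integrableOn_cell continuous_const L
  · exact Eventually.of_forall fun p s hs => h.hasDerivAt_dt (lt_of_lt_of_le (by positivity) hs.1) p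

lemma continuousOn_J (h : IsSmoothFamily L U) (n : ℕ) :
    ContinuousOn (fun t => J L n (U t)) (Set.Ioi 0) := by
  unfold J
  refine continuousOn_finsetSum _ fun ij _ => continuousOn_const.mul fun t ht => ?_
  exact ((h.mixedDeriv ij.1 ij.2).sq.hasDerivAt_integral ht).continuousAt.continuousWithinAt

lemma hasDerivAt_J_zero (h : IsSmoothFamily L U) (ht : 0 < t) :
    HasDerivAt (fun s => J L 0 (U s)) (2 * ∫ p in cell L, U t p * dt U t p) t := by
  simp only [J_zero]
  convert! h.sq.hasDerivAt_integral ht using 1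
  rw [← integral_const_mul]
  congr 1
  funext p
  refine Eq.trans ?_ ((h.hasDerivAt_dt ht p).fun_pow 2).deriv.symm
  push_cast
  ring

lemma hasDerivAt_J_one (hL : 0 ≤ L) (h : IsSmoothFamily L U) (ht : 0 < t) :
    HasDerivAt (fun s => J L 1 (U s)) (2 * ∫ p in cell L, -(lap (U t) p * dt U t p)) t := by
  have h1 := (h.dx.sq.add h.dy.sq).hasDerivAt_integral ht
  have h2 : (fun s => ∫ p in cell L, (MKS.dx (U s) p ^ 2 + MKS.dy (U s) p ^ 2))
      =ᶠ[𝓝 t] fun s => J L 1 (U s) :=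
    (eventually_gt_nhds ht).mono fun s hs => (J_one (h.slice hs)).symm
  refine (h1.congr_of_eventuallyEq h2.symm).congr_deriv ?_
  have hs := h.slice ht
  have hd := h.time_deriv.slice ht
  have c1 := hs.dx.continuous
  have c2 := hs.dy.continuous
  have c3 := hd.dx.continuous
  have c4 := hd.dy.continuous
  have c5 := hs.lap.continuous
  have c6 := hd.continuous
  have e : ∀ p, dt (fun t p => MKS.dx (U t) p ^ 2 + MKS.dy (U t) p ^ 2) t p
      = 2 * (MKS.dx (U t) p * MKS.dx (dt U t) p + MKS.dy (U t) p * MKS.dy (dt U t) p) := by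
    intro p
    rw [dt, (((h.dx.hasDerivAt_dt ht p).fun_pow 2).fun_add ((h.dy.hasDerivAt_dt ht p).fun_pow 2)).deriv,
      h.dt_dx ht, h.dt_dy ht]
    push_cast
    ring
  simp_rw [e]
  rw [integral_const_mul]
  congr 1
  refine integral_eq_of_sub_eq_div hL (by fun_prop) (by fun_prop) (hs.dx.mul hd) (hs.dy.mul hd)
    fun p => ?_
  rw [hs.dx.dx_mul hd, hs.dy.dy_mul hd, lap]
  ring

end IsSmoothFamily

/-! ### Energy inequalities -/

/-- The transport term in the balance of `J₁`, estimated by Agmon's inequality. -/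
lemma integral_lap_mul_le {L : ℝ} (hL : 0 < L) {φ : ℝ × ℝ → ℝ} (h : IsSmoothPeriodic L φ) :
    ∫ p in cell L, lap φ p * (φ p * (dx φ p + dy φ p))
      ≤ √(24 / Real.pi) * J L 2 φ * √(J L 0 φ) := by
  have hf := isSmoothPeriodic_fluct h
  have hpi := Real.pi_pos
  have c0 := h.continuous
  have c1 := h.dx.continuous
  have c2 := h.dy.continuous
  have c3 := h.lap.continuous
  have c4 := hf.continuous
  have hJ0 : 0 ≤ J L 0 φ := J_nonneg 0
  have hJ1 : 0 ≤ J L 1 φ := J_nonneg 1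
  have hJ2 : 0 ≤ J L 2 φ := J_nonneg 2
  -- The mean of `φ` does not contribute, since `Δφ (φ_x + φ_y)` is a divergence.
  have e1 : ∫ p in cell L, lap φ p * (φ p * (dx φ p + dy φ p))
      = ∫ p in cell L, (fluct L φ p * lap φ p) * (dx φ p + dy φ p) := by
    refine integral_eq_of_sub_eq_div hL.le (by fun_prop) (by fun_prop)
      ((((h.dx.pow 2).sub (h.dy.pow 2)).add ((h.dx.mul h.dy).const_mul 2)).const_mul
        (mean L φ / 2))
      (((((h.dx.mul h.dy).const_mul 2)).sub ((h.dx.pow 2).sub (h.dy.pow 2))).const_mul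
        (mean L φ / 2)) fun p => ?_
    rw [dx_const_mul, dy_const_mul,
      ((h.dx.pow 2).sub (h.dy.pow 2)).dx_add ((h.dx.mul h.dy).const_mul 2),
      ((h.dx.mul h.dy).const_mul 2).dy_sub ((h.dx.pow 2).sub (h.dy.pow 2)),
      (h.dx.pow 2).dx_sub (h.dy.pow 2), (h.dx.pow 2).dy_sub (h.dy.pow 2), dx_const_mul,
      dy_const_mul, h.dx.dx_mul h.dy, h.dx.dy_mul h.dy, h.dx.dx_pow, h.dx.dy_pow, h.dy.dx_pow,
      h.dy.dy_pow, h.dy_dx, fluct, lap]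
    push_cast
    ring
  have e2 := integral_mul_sq_le (L := L) (f := fun p => fluct L φ p * lap φ p)
    (g := fun p => dx φ p + dy φ p) (by fun_prop) (by fun_prop)
  have e3 : ∫ p in cell L, (fluct L φ p * lap φ p) ^ 2
      ≤ √(J L 0 φ * J L 2 φ) / Real.pi * J L 2 φ := by
    rw [J_two hL.le h, ← integral_const_mul, ← J_two hL.le h]
    refine integral_mono (integrableOn_cell (by fun_prop) L) (integrableOn_cell (by fun_prop) L)
      fun p => ?_
    show (fluct L φ p * lap φ p) ^ 2 ≤ _
    rw [mul_pow]
    exact mul_le_mul_of_nonneg_right (fluct_sq_le hL h p) (sq_nonneg _)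
  have e4 : ∫ p in cell L, (dx φ p + dy φ p) ^ 2 ≤ 2 * √(J L 0 φ * J L 2 φ) := by
    have : ∫ p in cell L, (dx φ p + dy φ p) ^ 2 ≤ 2 * J L 1 φ := by
      rw [J_one h, ← integral_const_mul]
      refine integral_mono (integrableOn_cell (by fun_prop) L) (integrableOn_cell (by fun_prop) L)
        fun p => ?_
      show (dx φ p + dy φ p) ^ 2 ≤ 2 * (dx φ p ^ 2 + dy φ p ^ 2)
      nlinarith [sq_nonneg (dx φ p - dy φ p)]
    have h1 : J L 1 φ ≤ √(J L 0 φ * J L 2 φ) := by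
      refine Real.le_sqrt_of_sq_le ?_
      rw [mul_comm]
      exact J_one_sq_le hL.le h
    linarith
  rw [e1]
  refine abs_le_of_sq_le_sq' ?_ (by positivity) |>.2
  calc _ ≤ _ := e2
    _ ≤ (√(J L 0 φ * J L 2 φ) / Real.pi * J L 2 φ) * (2 * √(J L 0 φ * J L 2 φ)) := by
      gcongr
    _ = (2 / Real.pi) * (J L 2 φ) ^ 2 * (√(J L 0 φ * J L 2 φ) ^ 2 / J L 2 φ) := by
      rcases hJ2.eq_or_lt with h0 | h0
      · simp [← h0]
      · field_simp
    _ ≤ (24 / Real.pi) * (J L 2 φ) ^ 2 * J L 0 φ := by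
      rw [Real.sq_sqrt (by positivity)]
      gcongr
      · norm_num
      · rcases hJ2.eq_or_lt with h0 | h0
        · simp [← h0, hJ0]
        · rw [mul_div_cancel_right₀ _ h0.ne']
    _ = _ := by
      rw [mul_pow, mul_pow, Real.sq_sqrt hJ0, Real.sq_sqrt (by positivity)]

lemma integral_pow_three_mul_lap_nonpos {L : ℝ} (hL : 0 ≤ L) {φ : ℝ × ℝ → ℝ}
    (h : IsSmoothPeriodic L φ) : ∫ p in cell L, φ p ^ 3 * lap φ p ≤ 0 := by
  have c0 := h.continuous
  have c1 := h.dx.continuous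
  have c2 := h.dy.continuous
  have c3 := h.lap.continuous
  have : ∫ p in cell L, φ p ^ 3 * lap φ p
      = ∫ p in cell L, -(3 * φ p ^ 2 * (dx φ p ^ 2 + dy φ p ^ 2)) := by
    refine integral_eq_of_sub_eq_div hL (by fun_prop) (by fun_prop) ((h.pow 3).mul h.dx)
      ((h.pow 3).mul h.dy) fun p => ?_
    rw [(h.pow 3).dx_mul h.dx, (h.pow 3).dy_mul h.dy, h.dx_pow, h.dy_pow, lap]
    push_cast
    ring
  rw [this, integral_neg, neg_nonpos]
  exact integral_nonneg fun p => by positivity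

lemma integral_sq_mul_grad {L : ℝ} (hL : 0 ≤ L) {φ : ℝ × ℝ → ℝ} (h : IsSmoothPeriodic L φ) :
    ∫ p in cell L, φ p ^ 2 * (dx φ p + dy φ p) = 0 := by
  have c0 := h.continuous
  have c1 := h.dx.continuous
  have c2 := h.dy.continuous
  rw [integral_eq_of_sub_eq_div hL (b := fun _ => 0) (by fun_prop) continuous_const
    ((h.pow 3).const_mul (1 / 3)) ((h.pow 3).const_mul (1 / 3)) fun p => ?_]
  · simp
  · rw [dx_const_mul, dy_const_mul, h.dx_pow, h.dy_pow]
    push_cast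
    ring

lemma J_zero_sq_le {L : ℝ} (hL : 0 ≤ L) {φ : ℝ × ℝ → ℝ} (h : Continuous φ) :
    J L 0 φ ^ 2 ≤ L ^ 2 * ∫ p in cell L, φ p ^ 4 := by
  have := integral_mul_sq_le (L := L) (f := fun p => φ p ^ 2) (g := fun _ => 1) (by fun_prop)
    continuous_const
  simp only [mul_one, one_pow, ← pow_mul] at this
  rw [integral_const_cell hL, mul_one] at this
  rw [J_zero]
  linarith

section solution

variable {L lam t : ℝ} {u₀ : ℝ × ℝ → ℝ} {u : ℝ → ℝ × ℝ → ℝ}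

lemma IsSolution.isSmoothFamily (h : IsSolution L lam u₀ u) : IsSmoothFamily L u :=
  ⟨h.smooth, h.periodic_x, h.periodic_y⟩

lemma IsSolution.isSmoothPeriodic (h : IsSolution L lam u₀ u) (ht : 0 < t) :
    IsSmoothPeriodic L (u t) := h.isSmoothFamily.slice ht

/-- The energy balance for `J₀`. -/
lemma IsSolution.integral_mul_dt (hL : 0 ≤ L) (h : IsSolution L lam u₀ u) (ht : 0 < t) :
    ∫ p in cell L, u t p * dt u t p
      = -J L 2 (u t) + J L 1 (u t) + lam * J L 0 (u t) - ∫ p in cell L, u t p ^ 4 := by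
  have hs := h.isSmoothPeriodic ht
  have c0 := hs.continuous
  have c1 := hs.dx.continuous
  have c2 := hs.dy.continuous
  have c3 := hs.lap.continuous
  have c4 := hs.lap.lap.continuous
  have e : ∀ p, u t p * dt u t p = -(u t p * lap (lap (u t)) p) + -(u t p * lap (u t) p)
      + lam * u t p ^ 2 - u t p ^ 4 - u t p ^ 2 * (dx (u t) p + dy (u t) p) := fun p => by
    rw [dt, h.pde t ht]; ring
  simp_rw [e]
  rw [integral_sub (integrableOn_cell (by fun_prop) L) (integrableOn_cell (by fun_prop) L),
    integral_sub (integrableOn_cell (by fun_prop) L) (integrableOn_cell (by fun_prop) L),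
    integral_add (integrableOn_cell (by fun_prop) L) (integrableOn_cell (by fun_prop) L),
    integral_add (integrableOn_cell (by fun_prop) L) (integrableOn_cell (by fun_prop) L),
    integral_sq_mul_grad hL hs, ← J_one_eq hL hs, integral_const_mul, ← J_zero, integral_neg,
    integral_mul_lap_comm hL hs hs.lap, J_two hL hs]
  simp only [← sq]
  ring

/-- The energy inequality for `J₁`. -/
lemma IsSolution.integral_neg_lap_mul_dt_le (hL : 0 < L) (h : IsSolution L lam u₀ u) (ht : 0 < t) :
    ∫ p in cell L, -(lap (u t) p * dt u t p)
      ≤ -J L 3 (u t) + (J L 2 (u t) + lam * J L 1 (u t)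
        + √(24 / Real.pi) * (J L 2 (u t) * √(J L 0 (u t)))) := by
  have hs := h.isSmoothPeriodic ht
  have c0 := hs.continuous
  have c1 := hs.dx.continuous
  have c2 := hs.dy.continuous
  have c3 := hs.lap.continuous
  have c4 := hs.lap.lap.continuous
  have e : ∀ p, -(lap (u t) p * dt u t p) = -(-(lap (u t) p * lap (lap (u t)) p))
      + lap (u t) p ^ 2 + lam * -(u t p * lap (u t) p) + u t p ^ 3 * lap (u t) p
      + lap (u t) p * (u t p * (dx (u t) p + dy (u t) p)) := fun p => by
    rw [dt, h.pde t ht]; ring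
  simp_rw [e]
  rw [integral_add (integrableOn_cell (by fun_prop) L) (integrableOn_cell (by fun_prop) L),
    integral_add (integrableOn_cell (by fun_prop) L) (integrableOn_cell (by fun_prop) L),
    integral_add (integrableOn_cell (by fun_prop) L) (integrableOn_cell (by fun_prop) L),
    integral_add (integrableOn_cell (by fun_prop) L) (integrableOn_cell (by fun_prop) L),
    integral_const_mul, ← J_one_eq hL.le hs, integral_neg, ← J_one_eq hL.le hs.lap, J_one hs.lap,
    ← J_three hL.le hs, ← J_two hL.le hs]
  have h1 := integral_lap_mul_le hL hs
  have h2 := integral_pow_three_mul_lap_nonpos hL.le hs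
  linarith

/-- The differential inequality for `J₀` with the quartic term kept. -/
lemma IsSolution.deriv_J_zero_le (hL : 0 < L) (h : IsSolution L lam u₀ u) (ht : 0 < t) :
    2 * ∫ p in cell L, u t p * dt u t p
      ≤ 2 / L ^ 2 * J L 0 (u t) * (B0 L lam - J L 0 (u t)) := by
  have hs := h.isSmoothPeriodic ht
  have h1 := J_one_sq_le hL.le hs
  have h2 := J_zero_sq_le hL.le hs.continuous
  have h3 : 0 ≤ J L 0 (u t) := J_nonneg 0
  have h4 : 0 ≤ J L 2 (u t) := J_nonneg 2
  have h5 : J L 1 (u t) ≤ J L 2 (u t) + J L 0 (u t) / 4 := by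
    refine abs_le_of_sq_le_sq' ?_ (by positivity) |>.2
    nlinarith [sq_nonneg (J L 2 (u t) - J L 0 (u t) / 4)]
  have h6 : J L 0 (u t) ^ 2 / L ^ 2 ≤ ∫ p in cell L, u t p ^ 4 := by
    rw [div_le_iff₀ (by positivity)]; linarith
  have e : 2 / L ^ 2 * J L 0 (u t) * (B0 L lam - J L 0 (u t))
      = 2 * ((lam + 1 / 4) * J L 0 (u t) - J L 0 (u t) ^ 2 / L ^ 2) := by
    rw [B0]; field_simp
  rw [h.integral_mul_dt hL.le ht, e]
  linarith

/-- The differential inequality for `J₀` with the quartic term dropped. -/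
lemma IsSolution.deriv_J_zero_le' (hL : 0 < L) (h : IsSolution L lam u₀ u) (ht : 0 < t) :
    2 * ∫ p in cell L, u t p * dt u t p
      ≤ (2 * lam + 1) * J L 0 (u t) - J L 2 (u t) := by
  have hs := h.isSmoothPeriodic ht
  have h1 := J_one_sq_le hL.le hs
  have h3 : 0 ≤ J L 0 (u t) := J_nonneg 0
  have h4 : 0 ≤ J L 2 (u t) := J_nonneg 2
  have h5 : J L 1 (u t) ≤ J L 2 (u t) / 2 + J L 0 (u t) / 2 := by
    refine abs_le_of_sq_le_sq' ?_ (by positivity) |>.2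
    nlinarith [sq_nonneg (J L 2 (u t) - J L 0 (u t))]
  have h6 : 0 ≤ ∫ p in cell L, u t p ^ 4 := integral_nonneg fun p => by positivity
  rw [h.integral_mul_dt hL.le ht]
  linarith

end solution

/-! ### Time averages -/

section timeAvg

variable {t₀ : ℝ} {F G : ℝ → ℝ}

lemma timeAvg_mono (h : ∀ t > t₀, F t ≤ G t) : timeAvg t₀ F ≤ timeAvg t₀ G := by
  refine limsup_le_limsup (Eventually.of_forall fun T => ?_)
  exact ENNReal.div_le_div_right (setLIntegral_mono' measurableSet_Ioc
    fun t ht => ENNReal.ofReal_le_ofReal (h t ht.1)) _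

lemma timeAvg_const_mul {c : ℝ} (hc : 0 ≤ c) :
    timeAvg t₀ (fun t => c * F t) = ENNReal.ofReal c * timeAvg t₀ F := by
  rw [timeAvg, timeAvg, ← ENNReal.limsup_const_mul_of_ne_top ENNReal.ofReal_ne_top]
  congr 1
  funext T
  simp_rw [ENNReal.ofReal_mul hc]
  rw [lintegral_const_mul' _ _ ENNReal.ofReal_ne_top, mul_div_assoc]

lemma tendsto_const_div_ofReal {C : ℝ≥0∞} (hC : C ≠ ⊤) :
    Tendsto (fun T : ℝ => C / ENNReal.ofReal T) atTop (𝓝 0) := by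
  have := ENNReal.Tendsto.const_div (a := C)
    ENNReal.tendsto_ofReal_atTop (Or.inr hC)
  simpa using this

lemma limsup_add_le_add {ι : Type*} {l : Filter ι} (f g : ι → ℝ≥0∞) :
    limsup (fun i => f i + g i) l ≤ limsup f l + limsup g l := by
  refine ENNReal.le_of_forall_pos_le_add fun ε hε hfin => ?_
  have hε' : (ε / 2 : ℝ≥0∞) ≠ 0 := (ENNReal.half_pos (by simpa using hε.ne')).ne'
  have hf := ENNReal.lt_add_right (lt_of_le_of_lt le_self_add hfin).ne hε'
  have hg := ENNReal.lt_add_right (lt_of_le_of_lt le_add_self hfin).ne hε'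
  refine limsup_le_of_le (h := ?_)
  filter_upwards [eventually_lt_of_limsup_lt hf, eventually_lt_of_limsup_lt hg] with i h1 h2
  refine (add_le_add h1.le h2.le).trans (le_of_eq ?_)
  rw [add_add_add_comm, ENNReal.add_halves]

/-- A bounded contribution does not affect time averages. -/
lemma limsup_div_le_of_le_const_add {f g : ℝ → ℝ≥0∞} {C : ℝ≥0∞} (hC : C ≠ ⊤)
    (h : ∀ᶠ T in atTop, f T ≤ C + g T) :
    limsup (fun T => f T / ENNReal.ofReal T) atTop
      ≤ limsup (fun T => g T / ENNReal.ofReal T) atTop := by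
  have h1 : limsup (fun T => f T / ENNReal.ofReal T) atTop
      ≤ limsup (fun T => C / ENNReal.ofReal T + g T / ENNReal.ofReal T) atTop := by
    refine limsup_le_limsup (h.mono fun T hT => ?_)
    show f T / ENNReal.ofReal T ≤ C / ENNReal.ofReal T + g T / ENNReal.ofReal T
    rw [← ENNReal.add_div]
    exact ENNReal.div_le_div_right hT _
  have h2 := h1.trans (limsup_add_le_add _ _)
  rwa [(tendsto_const_div_ofReal hC).limsup_eq, zero_add] at h2

lemma timeAvg_const {c : ℝ} : timeAvg t₀ (fun _ => c) = ENNReal.ofReal c := by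
  refine (Tendsto.congr' ?_ tendsto_const_nhds).limsup_eq
  filter_upwards [eventually_gt_atTop 0] with T hT
  rw [setLIntegral_const, Real.volume_Ioc, add_sub_cancel_left, mul_div_assoc,
    ENNReal.div_self (by simpa using hT) ENNReal.ofReal_ne_top, mul_one]

lemma timeAvg_add_le (hF : ∀ t > t₀, 0 ≤ F t) (hG : ∀ t > t₀, 0 ≤ G t)
    (hm : AEMeasurable F (volume.restrict (Set.Ioi t₀))) :
    timeAvg t₀ (fun t => F t + G t) ≤ timeAvg t₀ F + timeAvg t₀ G := by
  refine le_of_eq_of_le ?_ (limsup_add_le_add _ _)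
  rw [timeAvg]
  congr 1
  funext T
  rw [← ENNReal.add_div, ← lintegral_add_left'
    (hm.mono_measure (Measure.restrict_mono Set.Ioc_subset_Ioi_self le_rfl)).ennreal_ofReal]
  congr 1
  exact setLIntegral_congr_fun measurableSet_Ioc
    fun t ht => ENNReal.ofReal_add (hF t ht.1) (hG t ht.1)

lemma limsup_rpow {ι : Type*} {l : Filter ι} (f : ι → ℝ≥0∞) {r : ℝ} (hr : 0 < r) :
    limsup (fun i => f i ^ r) l = limsup f l ^ r :=
  ((ENNReal.orderIsoRpow r hr).limsup_apply (u := f) (f := l)).symm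

/-- Hölder's inequality for time averages. -/
lemma timeAvg_rpow_mul_rpow_le {p q : ℝ} (hpq : p.HolderConjugate q)
    (hF : ∀ t > t₀, 0 ≤ F t) (hG : ∀ t > t₀, 0 ≤ G t)
    (hFm : AEMeasurable F (volume.restrict (Set.Ioi t₀)))
    (hGm : AEMeasurable G (volume.restrict (Set.Ioi t₀)))
    (hG' : timeAvg t₀ G ≠ ⊤) (hFG : timeAvg t₀ F ≠ ⊤ ∨ timeAvg t₀ G ≠ 0) :
    timeAvg t₀ (fun t => F t ^ (1 / p) * G t ^ (1 / q))
      ≤ timeAvg t₀ F ^ (1 / p) * timeAvg t₀ G ^ (1 / q) := by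
  have hp : 0 < 1 / p := hpq.one_div_pos
  have hq : 0 < 1 / q := hpq.symm.one_div_pos
  have hsub : ∀ T, volume.restrict (Set.Ioc t₀ (t₀ + T)) ≤ volume.restrict (Set.Ioi t₀) :=
    fun T => Measure.restrict_mono Set.Ioc_subset_Ioi_self le_rfl
  have key : ∀ᶠ T in atTop,
      (∫⁻ t in Set.Ioc t₀ (t₀ + T), ENNReal.ofReal (F t ^ (1 / p) * G t ^ (1 / q)))
          / ENNReal.ofReal T
        ≤ ((∫⁻ t in Set.Ioc t₀ (t₀ + T), ENNReal.ofReal (F t)) / ENNReal.ofReal T) ^ (1 / p)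
          * ((∫⁻ t in Set.Ioc t₀ (t₀ + T), ENNReal.ofReal (G t)) / ENNReal.ofReal T) ^ (1 / q) := by
    filter_upwards [eventually_gt_atTop 0] with T hT
    have h1 := ENNReal.lintegral_mul_le_Lp_mul_Lq (volume.restrict (Set.Ioc t₀ (t₀ + T))) hpq
      (f := fun t => ENNReal.ofReal (F t) ^ (1 / p)) (g := fun t => ENNReal.ofReal (G t) ^ (1 / q))
      ((hFm.mono_measure (hsub T)).ennreal_ofReal.pow_const _)
      ((hGm.mono_measure (hsub T)).ennreal_ofReal.pow_const _)
    simp only [← ENNReal.rpow_mul, one_div_mul_cancel hpq.ne_zero,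
      one_div_mul_cancel hpq.symm.ne_zero, ENNReal.rpow_one, Pi.mul_apply] at h1
    have h2 : ∫⁻ t in Set.Ioc t₀ (t₀ + T), ENNReal.ofReal (F t ^ (1 / p) * G t ^ (1 / q))
        = ∫⁻ t in Set.Ioc t₀ (t₀ + T),
          ENNReal.ofReal (F t) ^ (1 / p) * ENNReal.ofReal (G t) ^ (1 / q) := by
      refine setLIntegral_congr_fun measurableSet_Ioc fun t ht => ?_
      show ENNReal.ofReal _ = _
      rw [ENNReal.ofReal_mul (Real.rpow_nonneg (hF t ht.1) _),
        ENNReal.ofReal_rpow_of_nonneg (hF t ht.1) hp.le,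
        ENNReal.ofReal_rpow_of_nonneg (hG t ht.1) hq.le]
    rw [h2]
    refine (ENNReal.div_le_div_right h1 _).trans (le_of_eq ?_)
    rw [ENNReal.div_rpow_of_nonneg _ _ hp.le, ENNReal.div_rpow_of_nonneg _ _ hq.le]
    have hT0 : ENNReal.ofReal T ≠ 0 := by simpa using hT
    have hTT : ENNReal.ofReal T ^ (1 / p) * ENNReal.ofReal T ^ (1 / q) = ENNReal.ofReal T := by
      rw [← ENNReal.rpow_add _ _ hT0 ENNReal.ofReal_ne_top]
      simp [hpq.inv_add_inv_eq_one]
    have hne : ∀ r, ENNReal.ofReal T ^ (r : ℝ) ≠ 0 := fun r => by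
      simp [ENNReal.rpow_eq_zero_iff, hT]
    nth_rewrite 1 [← hTT]
    rw [div_eq_mul_inv, ENNReal.mul_inv (Or.inl (hne _)) (Or.inr (hne _))]
    simp only [div_eq_mul_inv]
    ring
  refine (limsup_le_limsup key).trans ?_
  have hlF := limsup_rpow (l := atTop)
    (fun T => (∫⁻ t in Set.Ioc t₀ (t₀ + T), ENNReal.ofReal (F t)) / ENNReal.ofReal T) hp
  have hlG := limsup_rpow (l := atTop)
    (fun T => (∫⁻ t in Set.Ioc t₀ (t₀ + T), ENNReal.ofReal (G t)) / ENNReal.ofReal T) hq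
  refine (ENNReal.limsup_mul_le' ?_ ?_).trans ?_
  · rw [hlG]
    exact Or.inr (ENNReal.rpow_ne_top_of_nonneg hq.le hG')
  · rw [hlF, hlG]
    refine hFG.imp (ENNReal.rpow_ne_top_of_nonneg hp.le) fun h h0 => h ?_
    exact (ENNReal.rpow_eq_zero_iff_of_pos hq).1 h0
  · rw [hlF, hlG]
    rfl

lemma lintegral_Ioc_ne_top (ht₀ : 0 < t₀) (hF : ContinuousOn F (Set.Ioi 0)) (t : ℝ) :
    ∫⁻ s in Set.Ioc t₀ t, ENNReal.ofReal (F s) ≠ ⊤ := by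
  have : IntegrableOn F (Set.Ioc t₀ t) :=
    ((hF.mono fun s hs => lt_of_lt_of_le ht₀ hs.1).integrableOn_Icc (a := t₀) (b := t)).mono_set
      Set.Ioc_subset_Icc_self
  exact this.lintegral_lt_top.ne

lemma aemeasurable_Ioi (ht₀ : 0 < t₀) (hF : ContinuousOn F (Set.Ioi 0)) :
    AEMeasurable F (volume.restrict (Set.Ioi t₀)) :=
  (hF.mono (Set.Ioi_subset_Ioi ht₀.le)).aemeasurable measurableSet_Ioi

/-- In a time average, a factor can be replaced by its time-asymptotic value. -/
lemma timeAvg_mul_le (ht₀ : 0 < t₀) (hF : ContinuousOn F (Set.Ioi 0))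
    (hG : ContinuousOn G (Set.Ioi 0)) (hF0 : ∀ t > 0, 0 ≤ F t) (hF' : timeAvg t₀ F ≠ ⊤)
    (hG' : asymp G ≠ ⊤) : timeAvg t₀ (fun t => F t * G t) ≤ timeAvg t₀ F * asymp G := by
  have hlim : Tendsto (fun M => timeAvg t₀ F * M) (𝓝[>] asymp G) (𝓝 (timeAvg t₀ F * asymp G)) :=
    ENNReal.Tendsto.const_mul (tendsto_nhdsWithin_of_tendsto_nhds tendsto_id) (Or.inr hF')
  have : (𝓝[>] asymp G).NeBot := nhdsGT_neBot_of_exists_gt ⟨⊤, hG'.lt_top⟩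
  refine ge_of_tendsto hlim ?_
  filter_upwards [Ioo_mem_nhdsGT hG'.lt_top] with M hM
  obtain ⟨t₁, ht₁⟩ := eventually_atTop.1 (eventually_lt_of_limsup_lt hM.1)
  have h1 : timeAvg t₀ (fun t => F t * G t) ≤ limsup (fun T : ℝ =>
      (M * ∫⁻ t in Set.Ioc t₀ (t₀ + T), ENNReal.ofReal (F t)) / ENNReal.ofReal T) atTop := by
    refine limsup_div_le_of_le_const_add (lintegral_Ioc_ne_top ht₀ (hF.mul hG) t₁)
      (Eventually.of_forall fun T => ?_)
    have hsub : Set.Ioc t₀ (t₀ + T) ⊆ Set.Ioc t₀ t₁ ∪ Set.Ioc t₀ (t₀ + T) ∩ Set.Ioi t₁ := by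
      intro t ht
      rcases le_or_gt t t₁ with h | h
      · exact Or.inl ⟨ht.1, h⟩
      · exact Or.inr ⟨ht, h⟩
    refine (lintegral_mono_set hsub).trans ((lintegral_union_le _ _ _).trans ?_)
    refine add_le_add le_rfl ?_
    rw [← lintegral_const_mul' _ _ hM.2.ne]
    refine (setLIntegral_mono' (measurableSet_Ioc.inter measurableSet_Ioi) fun t ht => ?_).trans
      (lintegral_mono_set Set.inter_subset_left)
    show ENNReal.ofReal (F t * G t) ≤ _
    rw [ENNReal.ofReal_mul (hF0 t (ht₀.trans ht.1.1)), mul_comm]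
    gcongr
    exact (ht₁ t (le_of_lt ht.2)).le
  refine h1.trans (le_of_eq ?_)
  simp_rw [mul_div_assoc]
  rw [ENNReal.limsup_const_mul_of_ne_top hM.2.ne, mul_comm]
  rfl

lemma timeAvg_le_asymp (ht₀ : 0 < t₀) (hF : ContinuousOn F (Set.Ioi 0)) (hF' : asymp F ≠ ⊤) :
    timeAvg t₀ F ≤ asymp F := by
  have h1 : timeAvg t₀ (fun _ => 1) = 1 := by rw [timeAvg_const, ENNReal.ofReal_one]
  have := timeAvg_mul_le (F := fun _ => 1) ht₀ continuousOn_const hF (fun _ _ => zero_le_one)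
    (by rw [h1]; exact ENNReal.one_ne_top) hF'
  simpa [h1] using this

lemma lintegral_le_of_deriv_le {y y' : ℝ → ℝ} {a b : ℝ} (ha : 0 < a) (hab : a ≤ b)
    (hF : ContinuousOn F (Set.Ioi 0)) (hG : ContinuousOn G (Set.Ioi 0)) (hF0 : ∀ t > 0, 0 ≤ F t)
    (hy : ∀ t ≥ a, HasDerivAt y (y' t) t)
    (hle : ∀ t ≥ a, y' t ≤ G t - F t) :
    ∫⁻ t in Set.Ioc a b, ENNReal.ofReal (F t)
      ≤ ENNReal.ofReal (y a - y b + ∫ t in a..b, G t) := by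
  have hsub : Set.Icc a b ⊆ Set.Ioi 0 := fun s hs => lt_of_lt_of_le ha hs.1
  have iF : IntegrableOn F (Set.Icc a b) := (hF.mono hsub).integrableOn_Icc
  have iG : IntegrableOn G (Set.Icc a b) := (hG.mono hsub).integrableOn_Icc
  have h1 := intervalIntegral.sub_le_integral_of_hasDeriv_right_of_le hab
    (fun t ht => (hy t ht.1).continuousAt.continuousWithinAt)
    (fun t ht => (hy t ht.1.le).hasDerivWithinAt) (iG.sub iF) (fun t ht => hle t ht.1.le)
  have iF' := iF.mono_set Set.Ioc_subset_Icc_self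
  have iG' := iG.mono_set Set.Ioc_subset_Icc_self
  simp only [Pi.sub_apply] at h1
  rw [intervalIntegral.integral_sub ((intervalIntegrable_iff_integrableOn_Ioc_of_le hab).2 iG')
    ((intervalIntegrable_iff_integrableOn_Ioc_of_le hab).2 iF')] at h1
  rw [← ofReal_integral_eq_lintegral_ofReal iF'
    ((ae_restrict_mem measurableSet_Ioc).mono fun t ht => hF0 t (ha.trans ht.1)),
    ← intervalIntegral.integral_of_le hab]
  exact ENNReal.ofReal_le_ofReal (by linarith)

/-- The time average of a dissipation term `F` is at most that of the source `G` when a nonnegative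
energy `y` obeys `y' ≤ G - F`. -/
lemma timeAvg_le_of_deriv_le {y y' : ℝ → ℝ} (ht₀ : 0 < t₀)
    (hF : ContinuousOn F (Set.Ioi 0)) (hG : ContinuousOn G (Set.Ioi 0)) (hF0 : ∀ t > 0, 0 ≤ F t)
    (hG0 : ∀ t > 0, 0 ≤ G t) (hy0 : ∀ t > 0, 0 ≤ y t) (hy : ∀ t > 0, HasDerivAt y (y' t) t)
    (hle : ∀ t > 0, y' t ≤ G t - F t) : timeAvg t₀ F ≤ timeAvg t₀ G := by
  refine limsup_div_le_of_le_const_add (C := ENNReal.ofReal (y t₀)) ENNReal.ofReal_ne_top ?_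
  filter_upwards [eventually_gt_atTop 0] with T hT
  have hab : t₀ ≤ t₀ + T := by linarith
  have iG : IntegrableOn G (Set.Ioc t₀ (t₀ + T)) :=
    ((hG.mono fun s hs => lt_of_lt_of_le ht₀ hs.1).integrableOn_Icc
      (a := t₀) (b := t₀ + T)).mono_set Set.Ioc_subset_Icc_self
  have hG0' : 0 ≤ᵐ[volume.restrict (Set.Ioc t₀ (t₀ + T))] G :=
    (ae_restrict_mem measurableSet_Ioc).mono fun t ht => hG0 t (ht₀.trans ht.1)
  refine (lintegral_le_of_deriv_le ht₀ hab hF hG hF0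
    (fun t ht => hy t (lt_of_lt_of_le ht₀ ht)) (fun t ht => hle t (lt_of_lt_of_le ht₀ ht))).trans ?_
  rw [← ofReal_integral_eq_lintegral_ofReal iG hG0', ← intervalIntegral.integral_of_le hab,
    ← ENNReal.ofReal_add (hy0 t₀ ht₀) (by
      rw [intervalIntegral.integral_of_le hab]; exact integral_nonneg_of_ae hG0')]
  exact ENNReal.ofReal_le_ofReal (by linarith [hy0 (t₀ + T) (by linarith)])

end timeAvg

/-! ### Logistic differential inequalities -/

lemma sub_le_mul_of_deriv_le {y y' : ℝ → ℝ} {a b C : ℝ} (hab : a ≤ b)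
    (hy : ∀ t ≥ a, HasDerivAt y (y' t) t) (hle : ∀ t ∈ Set.Icc a b, y' t ≤ C) :
    y b - y a ≤ C * (b - a) := by
  refine (convex_Icc a b).image_sub_le_mul_sub_of_deriv_le
    (fun t ht => (hy t ht.1).continuousAt.continuousWithinAt)
    (fun t ht => (hy t (interior_subset ht).1).differentiableAt.differentiableWithinAt)
    (fun t ht => ?_) a (Set.left_mem_Icc.2 hab) b (Set.right_mem_Icc.2 hab) hab
  rw [(hy t (interior_subset ht).1).deriv]
  exact hle t (interior_subset ht)

/-- Nonnegative solutions of `y' ≤ c y (B - y)` are asymptotically at most `B`. -/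
lemma eventually_le_of_logistic {y y' : ℝ → ℝ} {c B ε : ℝ} (hc : 0 < c) (hB : 0 ≤ B) (hε : 0 < ε)
    (hy0 : ∀ t > 0, 0 ≤ y t) (hy : ∀ t > 0, HasDerivAt y (y' t) t)
    (hle : ∀ t > 0, y' t ≤ c * y t * (B - y t)) : ∀ᶠ t in atTop, y t ≤ B + ε := by
  have hd : 0 < c * (B + ε) * ε := by positivity
  obtain ⟨s, hs, hys⟩ : ∃ s ≥ (1 : ℝ), y s ≤ B + ε := by
    by_contra! hcon
    set b := 1 + (y 1 + 1) / (c * (B + ε) * ε) with hb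
    have hb1 : 1 ≤ b := by
      have := hy0 1 one_pos
      have : 0 ≤ (y 1 + 1) / (c * (B + ε) * ε) := by positivity
      linarith
    have h1 := sub_le_mul_of_deriv_le (C := -(c * (B + ε) * ε)) hb1
      (fun t ht => hy t (by linarith)) fun t ht => by
        have h2 := hcon t ht.1
        have h3 := hle t (by linarith [ht.1])
        have h4 : c * (B + ε) * ε ≤ c * y t * (y t - B) := by
          gcongr
          · exact mul_nonneg hc.le (hy0 t (by linarith [ht.1]))
          · linarith
        linarith
    have h2 : -(c * (B + ε) * ε) * (b - 1) = -(y 1 + 1) := by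
      rw [hb]; field_simp; ring
    have := hy0 b (by linarith)
    linarith
  filter_upwards [eventually_ge_atTop s] with t ht
  refine image_le_of_deriv_right_lt_deriv_boundary (a := s) (b := t) (B := fun _ => B + ε)
    (B' := fun _ => 0) (f' := y')
    (fun r hr => (hy r (by linarith [hr.1])).continuousAt.continuousWithinAt)
    (fun r hr => (hy r (by linarith [hr.1])).hasDerivWithinAt) hys
    (fun r => hasDerivAt_const r _) (fun r hr h => ?_) (Set.right_mem_Icc.2 ht)
  have := hle r (by linarith [hr.1])
  rw [h] at this
  linarith

/-! ### The crest factor at a fixed time -/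

section crest

variable {L : ℝ} {φ : ℝ × ℝ → ℝ}

lemma abs_le_supNorm (h : Continuous φ) {p : ℝ × ℝ} (hp : p ∈ cell L) : |φ p| ≤ supNorm L φ :=
  le_csSup ((isCompact_cell L).image h.abs).bddAbove (Set.mem_image_of_mem _ hp)

lemma supNorm_le (hL : 0 ≤ L) {M : ℝ} (h : ∀ p ∈ cell L, |φ p| ≤ M) : supNorm L φ ≤ M := by
  refine csSup_le (Set.Nonempty.image _ ⟨(0, 0), ?_⟩) ?_
  · exact ⟨⟨le_rfl, hL⟩, ⟨le_rfl, hL⟩⟩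
  · rintro _ ⟨p, hp, rfl⟩
    exact h p hp

lemma supNorm_nonneg : 0 ≤ supNorm L φ := by
  refine Real.sSup_nonneg ?_
  rintro _ ⟨p, -, rfl⟩
  exact abs_nonneg _

lemma crest_le (hL : 0 < L) (h : IsSmoothPeriodic L φ) :
    L * (supNorm L φ / √(J L 0 φ)) ≤ 1 + L * (supNorm L (fluct L φ) / √(J L 0 φ)) := by
  have h1 : supNorm L φ ≤ supNorm L (fluct L φ) + |mean L φ| := by
    refine supNorm_le hL.le fun p hp => ?_
    have h2 := abs_le_supNorm (isSmoothPeriodic_fluct h).continuous hp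
    have h3 : φ p = fluct L φ p + mean L φ := by rw [fluct]; ring
    rw [h3]
    exact (abs_add_le _ _).trans (by linarith)
  have h2 : L * |mean L φ| ≤ √(J L 0 φ) := by
    refine Real.le_sqrt_of_sq_le ?_
    rw [mul_pow, sq_abs]
    exact mean_sq_le hL h.continuous
  rcases (Real.sqrt_nonneg (J L 0 φ)).eq_or_lt with h0 | h0
  · rw [← h0]; simp
  · have h3 : 1 + L * (supNorm L (fluct L φ) / √(J L 0 φ))
        = (√(J L 0 φ) + L * supNorm L (fluct L φ)) / √(J L 0 φ) := by field_simp
    rw [h3, ← mul_div_assoc]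
    gcongr
    nlinarith

lemma one_le_crest (hL : 0 < L) (h : IsSmoothPeriodic L φ) (h0 : 0 < J L 0 φ) :
    1 ≤ L * (supNorm L φ / √(J L 0 φ)) := by
  have h1 : J L 0 φ ≤ (L * supNorm L φ) ^ 2 := by
    have c0 := h.continuous
    rw [J_zero, mul_pow, ← integral_const_cell hL.le]
    refine setIntegral_mono_on (integrableOn_cell (by fun_prop) L)
      (integrableOn_cell continuous_const L) (measurableSet_cell L) fun p hp => ?_
    rw [← sq_abs]
    exact pow_le_pow_left₀ (abs_nonneg _) (abs_le_supNorm c0 hp) 2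
  rw [← mul_div_assoc, one_le_div (Real.sqrt_pos.2 h0)]
  exact Real.sqrt_le_iff.2 ⟨mul_nonneg hL.le supNorm_nonneg, h1⟩

lemma crest_fluct_le (hL : 0 < L) (h : IsSmoothPeriodic L φ) :
    L * (supNorm L (fluct L φ) / √(J L 0 φ))
      ≤ Real.pi ^ (-(1 / 2) : ℝ) * L * (J L 2 φ / J L 0 φ) ^ (1 / 4 : ℝ) := by
  have hpi := Real.pi_pos
  have hJ2 : 0 ≤ J L 2 φ := J_nonneg 2
  rcases (J_nonneg 0 : 0 ≤ J L 0 φ).eq_or_lt with h0 | h0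
  · simp [← h0]
  have hs : supNorm L (fluct L φ) ≤ √(√(J L 0 φ * J L 2 φ) / Real.pi) :=
    supNorm_le hL.le fun p _ => Real.abs_le_sqrt (fluct_sq_le hL h p)
  set r := J L 2 φ / J L 0 φ with hr
  have hr0 : 0 ≤ r := by positivity
  have h2 : J L 2 φ = J L 0 φ * r := by rw [hr]; field_simp
  have h3 : √(√(J L 0 φ * J L 2 φ) / Real.pi)
      = √(J L 0 φ) * (Real.pi ^ (-(1 / 2) : ℝ) * r ^ (1 / 4 : ℝ)) := by
    rw [h2, ← mul_assoc, ← sq, Real.sqrt_mul (sq_nonneg _), Real.sqrt_sq h0.le,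
      Real.sqrt_div (by positivity), Real.sqrt_mul h0.le, Real.rpow_neg hpi.le,
      ← Real.sqrt_eq_rpow Real.pi]
    have : √√r = r ^ (1 / 4 : ℝ) := by
      rw [Real.sqrt_eq_rpow, Real.sqrt_eq_rpow, ← Real.rpow_mul hr0]; norm_num
    rw [this]
    field_simp
  have h4 : supNorm L (fluct L φ) / √(J L 0 φ) ≤ Real.pi ^ (-(1 / 2) : ℝ) * r ^ (1 / 4 : ℝ) := by
    rw [div_le_iff₀' (Real.sqrt_pos.2 h0), ← h3]
    exact hs
  calc _ ≤ L * (Real.pi ^ (-(1 / 2) : ℝ) * r ^ (1 / 4 : ℝ)) := by gcongr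
    _ = _ := by ring

end crest

/-! ### The quotient `J₂ / J₀` -/

section ratio

variable {L lam t₀ : ℝ} {u₀ : ℝ × ℝ → ℝ} {u : ℝ → ℝ × ℝ → ℝ}

lemma IsSolution.hasDerivAt_J_zero (h : IsSolution L lam u₀ u) {t : ℝ} (ht : 0 < t) :
    HasDerivAt (fun s => J L 0 (u s)) (2 * ∫ p in cell L, u t p * dt u t p) t :=
  h.isSmoothFamily.hasDerivAt_J_zero ht

/-- A solution that does not decay exponentially never vanishes: `J₀` grows at most exponentially,
so it would vanish from then on, and `J₂` with it. -/
lemma IsSolution.J_zero_pos (hL : 0 < L) (h : IsSolution L lam u₀ u) (hn : NoExpDecay L u) {t : ℝ}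
    (ht : 0 < t) : 0 < J L 0 (u t) := by
  by_contra! hcon
  set c := 2 * lam + 1
  have hzero : ∀ s ≥ t, J L 0 (u s) = 0 := by
    intro s hs
    have hd : ∀ r ≥ t, HasDerivAt (fun r => J L 0 (u r) * Real.exp (-c * r))
        ((2 * ∫ p in cell L, u r p * dt u r p) * Real.exp (-c * r)
          + J L 0 (u r) * (Real.exp (-c * r) * -c)) r := fun r hr =>
      (h.hasDerivAt_J_zero (ht.trans_le hr)).mul
        (by simpa using ((hasDerivAt_id r).const_mul (-c)).exp)
    have h1 := sub_le_mul_of_deriv_le (C := 0) hs hd fun r hr => by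
      have h2 := h.deriv_J_zero_le' hL (ht.trans_le hr.1)
      have h3 : 0 ≤ J L 2 (u r) := J_nonneg 2
      have h4 := Real.exp_pos (-c * r)
      have h5 : (2 * ∫ p in cell L, u r p * dt u r p) - c * J L 0 (u r) ≤ 0 := by linarith
      nlinarith
    have h2 : J L 0 (u s) * Real.exp (-c * s) ≤ 0 := by
      nlinarith [Real.exp_pos (-c * t)]
    have h3 : 0 ≤ J L 0 (u s) := J_nonneg 0
    nlinarith [Real.exp_pos (-c * s)]
  obtain ⟨s, hs, hst⟩ := ((hn 1 one_pos).and (eventually_ge_atTop t)).exists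
  have hs0 : 0 < s := ht.trans_le hst
  -- `J₀` has a minimum at `s`, so its derivative vanishes there.
  have hmin : IsLocalMin (fun r => J L 0 (u r)) s :=
    Eventually.of_forall fun r => by
      show J L 0 (u s) ≤ J L 0 (u r)
      rw [hzero s hst]
      exact J_nonneg 0
  have h1 := hmin.hasDerivAt_eq_zero (h.hasDerivAt_J_zero hs0)
  have h2 := h.deriv_J_zero_le' hL hs0
  rw [h1, hzero s hst] at h2
  rw [hzero s hst] at hs
  linarith [Real.exp_pos (-1 * s)]

/-- In every late time window of length one there is a time at which `J₀` itself is not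
exponentially small. Otherwise `J₂` would be bounded below on the window and its dissipation would
push `J₀` below zero. -/
lemma IsSolution.exists_le_J_zero (hL : 0 < L) (hlam : 0 < lam) (h : IsSolution L lam u₀ u)
    (hn : NoExpDecay L u) {ε : ℝ} (hε : 0 < ε) :
    ∀ᶠ T in atTop, ∃ t ∈ Set.Icc T (T + 1),
      Real.exp (-ε * (T + 1)) / (2 * lam + 4) ≤ J L 0 (u t) := by
  obtain ⟨t₁, ht₁⟩ := eventually_atTop.1 (hn ε hε)
  filter_upwards [eventually_ge_atTop t₁, eventually_gt_atTop 0] with T hT hT0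
  by_contra! hcon
  set E := Real.exp (-ε * (T + 1)) with hE
  have hE0 : 0 < E := Real.exp_pos _
  set κ := E / (2 * lam + 4) with hκ
  have hκE : E = (2 * lam + 4) * κ := by rw [hκ]; field_simp
  have hκ0 : 0 < κ := by positivity
  have h1 := sub_le_mul_of_deriv_le (C := (2 * lam + 1) * κ - (E - κ))
    (show T ≤ T + 1 by linarith) (fun t ht => h.hasDerivAt_J_zero (hT0.trans_le ht)) fun t ht => by
      have h2 := h.deriv_J_zero_le' hL (hT0.trans_le ht.1)
      have h3 := hcon t ht
      have h4 := ht₁ t (hT.trans ht.1)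
      have h5 : E ≤ Real.exp (-ε * t) := Real.exp_le_exp.2 (by nlinarith [ht.2])
      have h6 : (2 * lam + 1) * J L 0 (u t) ≤ (2 * lam + 1) * κ := by gcongr
      linarith
  have h2 := hcon T ⟨le_rfl, by linarith⟩
  have h3 : 0 ≤ J L 0 (u (T + 1)) := J_nonneg 0
  rw [hκE] at h1
  linarith

/-- The averaged quotient `J₂ / J₀` of a solution that does not decay exponentially, from the
logarithmic derivative of `J₀`. -/
theorem IsSolution.timeAvg_ratio_le (hL : 0 < L) (hlam : 0 < lam) (ht₀ : 0 < t₀)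
    (h : IsSolution L lam u₀ u) (hn : NoExpDecay L u) :
    timeAvg t₀ (fun t => J L 2 (u t) / J L 0 (u t)) ≤ ENNReal.ofReal (2 * lam + 1) := by
  have hpos : ∀ t > 0, 0 < J L 0 (u t) := fun t ht => h.J_zero_pos hL hn ht
  have hF : ContinuousOn (fun t => J L 2 (u t) / J L 0 (u t)) (Set.Ioi 0) :=
    (h.isSmoothFamily.continuousOn_J 2).div (h.isSmoothFamily.continuousOn_J 0)
      fun t ht => (hpos t ht).ne'
  refine ENNReal.le_of_forall_pos_le_add fun ε hε _ => ?_
  have hε : (0 : ℝ) < ε := hε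
  rw [← ENNReal.ofReal_coe_nnreal, ← ENNReal.ofReal_add (by positivity) hε.le]
  rw [← timeAvg_const (t₀ := t₀) (c := 2 * lam + 1 + (ε : ℝ))]
  set C := |Real.log (J L 0 (u t₀))| + ε * (t₀ + 1) + |Real.log (2 * lam + 4)| + (2 * lam + 1)
  have hC : 0 ≤ C := by positivity
  refine limsup_div_le_of_le_const_add (C := ENNReal.ofReal C) ENNReal.ofReal_ne_top ?_
  have hw := (tendsto_atTop_add_const_left atTop t₀ tendsto_id).eventually
    (h.exists_le_J_zero hL hlam hn hε)
  filter_upwards [hw, eventually_gt_atTop 0] with T hT hT0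
  obtain ⟨t, ht, hJ⟩ := hT
  simp only [id] at ht hJ
  have hab : t₀ ≤ t := by linarith [ht.1]
  have hy : ∀ s ≥ t₀, HasDerivAt (fun s => Real.log (J L 0 (u s)))
      ((2 * ∫ p in cell L, u s p * dt u s p) / J L 0 (u s)) s := fun s hs =>
    (h.hasDerivAt_J_zero (ht₀.trans_le hs)).log (hpos s (ht₀.trans_le hs)).ne'
  have h1 := lintegral_le_of_deriv_le ht₀ hab hF (continuousOn_const (c := 2 * lam + 1))
    (fun s _ => div_nonneg (J_nonneg 2) (J_nonneg 0)) hy fun s hs => by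
      have h0 := hpos s (ht₀.trans_le hs)
      rw [div_le_iff₀ h0, sub_mul, div_mul_cancel₀ _ h0.ne']
      exact h.deriv_J_zero_le' hL (ht₀.trans_le hs)
  have h2 : -Real.log (J L 0 (u t)) ≤ ε * (t₀ + T + 1) + Real.log (2 * lam + 4) := by
    have := Real.log_le_log (by positivity) hJ
    rw [Real.log_div (Real.exp_pos _).ne' (by positivity), Real.log_exp] at this
    linarith
  have hconst : ∫ _s in t₀..t, (2 * lam + 1) ≤ (2 * lam + 1) * (T + 1) := by
    rw [intervalIntegral.integral_const, smul_eq_mul, mul_comm]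
    gcongr
    linarith [ht.2]
  rw [setLIntegral_const, Real.volume_Ioc, add_sub_cancel_left,
    ← ENNReal.ofReal_mul (by positivity), ← ENNReal.ofReal_add hC (by positivity)]
  refine (lintegral_mono_set (Set.Ioc_subset_Ioc_right ht.1)).trans
    (h1.trans (ENNReal.ofReal_le_ofReal ?_))
  have h3 := le_abs_self (Real.log (J L 0 (u t₀)))
  have h4 := le_abs_self (Real.log (2 * lam + 4))
  simp only [C]
  nlinarith

end ratio

/-! ### Averaged norms and crest factors of a solution -/

section averages

variable {L lam t₀ : ℝ} {u₀ : ℝ × ℝ → ℝ} {u : ℝ → ℝ × ℝ → ℝ}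

lemma B0_nonneg (L : ℝ) (hlam : 0 < lam) : 0 ≤ B0 L lam := by unfold B0; positivity

lemma B1_nonneg (L : ℝ) (hlam : 0 < lam) : 0 ≤ B1 L lam := by unfold B1; positivity

lemma B3_nonneg (hL : 0 < L) (hlam : 0 < lam) : 0 ≤ B3 L lam := by
  have := Real.pi_pos
  unfold B3; positivity

lemma IsSolution.continuousOn_J (h : IsSolution L lam u₀ u) (n : ℕ) :
    ContinuousOn (fun t => J L n (u t)) (Set.Ioi 0) := h.isSmoothFamily.continuousOn_J n

lemma IsSolution.asymp_J_zero_le (hL : 0 < L) (hlam : 0 < lam) (h : IsSolution L lam u₀ u) :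
    asymp (fun t => J L 0 (u t)) ≤ ENNReal.ofReal (B0 L lam) := by
  refine ENNReal.le_of_forall_pos_le_add fun ε hε _ => ?_
  rw [← ENNReal.ofReal_coe_nnreal, ← ENNReal.ofReal_add (B0_nonneg L hlam) ε.coe_nonneg]
  refine limsup_le_of_le (h := ?_)
  refine (eventually_le_of_logistic (c := 2 / L ^ 2) (ε := ε) (by positivity) (B0_nonneg L hlam)
    hε (fun t _ => J_nonneg 0) (fun t ht => h.hasDerivAt_J_zero ht)
    fun t ht => h.deriv_J_zero_le hL ht).mono fun t ht => ENNReal.ofReal_le_ofReal ht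

lemma IsSolution.timeAvg_J_zero_le (hL : 0 < L) (hlam : 0 < lam) (ht₀ : 0 < t₀)
    (h : IsSolution L lam u₀ u) :
    timeAvg t₀ (fun t => J L 0 (u t)) ≤ asymp (fun t => J L 0 (u t)) :=
  timeAvg_le_asymp ht₀ (h.continuousOn_J 0)
    ((h.asymp_J_zero_le hL hlam).trans_lt ENNReal.ofReal_lt_top).ne

lemma IsSolution.timeAvg_J_two_le (hL : 0 < L) (hlam : 0 < lam) (ht₀ : 0 < t₀)
    (h : IsSolution L lam u₀ u) :
    timeAvg t₀ (fun t => J L 2 (u t))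
      ≤ ENNReal.ofReal (2 * lam + 1) * timeAvg t₀ (fun t => J L 0 (u t)) := by
  rw [← timeAvg_const_mul (by positivity)]
  exact timeAvg_le_of_deriv_le ht₀ (h.continuousOn_J 2)
    (continuousOn_const.mul (h.continuousOn_J 0)) (fun t _ => J_nonneg 2)
    (fun t _ => mul_nonneg (by positivity) (J_nonneg 0)) (fun t _ => J_nonneg 0)
    (fun t ht => h.hasDerivAt_J_zero ht) fun t ht => h.deriv_J_zero_le' hL ht

lemma IsSolution.timeAvg_J_two_le_B2 (hL : 0 < L) (hlam : 0 < lam) (ht₀ : 0 < t₀)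
    (h : IsSolution L lam u₀ u) :
    timeAvg t₀ (fun t => J L 2 (u t)) ≤ ENNReal.ofReal (B2 L lam) := by
  have e : B2 L lam = (2 * lam + 1) * B0 L lam := by rw [B2, B0]; ring
  rw [e, ENNReal.ofReal_mul (by positivity)]
  refine (h.timeAvg_J_two_le hL hlam ht₀).trans ?_
  gcongr
  exact (h.timeAvg_J_zero_le hL hlam ht₀).trans (h.asymp_J_zero_le hL hlam)

lemma IsSolution.timeAvg_J_one_le (hL : 0 < L) (hlam : 0 < lam) (ht₀ : 0 < t₀)
    (h : IsSolution L lam u₀ u) :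
    timeAvg t₀ (fun t => J L 1 (u t)) ≤ timeAvg t₀ (fun t => J L 2 (u t)) ^ (1 / 2 : ℝ)
      * timeAvg t₀ (fun t => J L 0 (u t)) ^ (1 / 2 : ℝ) := by
  refine (timeAvg_mono fun t ht => ?_).trans (timeAvg_rpow_mul_rpow_le Real.HolderConjugate.two_two
    (fun t _ => J_nonneg 2) (fun t _ => J_nonneg 0) (aemeasurable_Ioi ht₀ (h.continuousOn_J 2))
    (aemeasurable_Ioi ht₀ (h.continuousOn_J 0)) ?_ (Or.inl ?_))
  · rw [← Real.sqrt_eq_rpow, ← Real.sqrt_eq_rpow, ← Real.sqrt_mul (J_nonneg 2)]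
    exact Real.le_sqrt_of_sq_le (J_one_sq_le hL.le (h.isSmoothPeriodic (ht₀.trans ht)))
  · exact ((h.timeAvg_J_zero_le hL hlam ht₀).trans_lt
      ((h.asymp_J_zero_le hL hlam).trans_lt ENNReal.ofReal_lt_top)).ne
  · exact ((h.timeAvg_J_two_le_B2 hL hlam ht₀).trans_lt ENNReal.ofReal_lt_top).ne

lemma IsSolution.timeAvg_J_one_le_mul (hL : 0 < L) (hlam : 0 < lam) (ht₀ : 0 < t₀)
    (h : IsSolution L lam u₀ u) :
    timeAvg t₀ (fun t => J L 1 (u t))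
      ≤ ENNReal.ofReal √(2 * lam + 1) * timeAvg t₀ (fun t => J L 0 (u t)) := by
  refine (h.timeAvg_J_one_le hL hlam ht₀).trans ?_
  set a := timeAvg t₀ (fun t => J L 0 (u t))
  calc _ ≤ (ENNReal.ofReal (2 * lam + 1) * a) ^ (1 / 2 : ℝ) * a ^ (1 / 2 : ℝ) := by
        gcongr
        exact h.timeAvg_J_two_le hL hlam ht₀
    _ = _ := by
      rw [ENNReal.mul_rpow_of_nonneg _ _ (by norm_num), mul_assoc,
        ← ENNReal.rpow_add_of_nonneg _ _ (by norm_num) (by norm_num), Real.sqrt_eq_rpow,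
        ENNReal.ofReal_rpow_of_nonneg (by positivity) (by norm_num)]
      norm_num

lemma IsSolution.timeAvg_J_one_le_B1 (hL : 0 < L) (hlam : 0 < lam) (ht₀ : 0 < t₀)
    (h : IsSolution L lam u₀ u) :
    timeAvg t₀ (fun t => J L 1 (u t)) ≤ ENNReal.ofReal (B1 L lam) := by
  have e : B1 L lam = √(2 * lam + 1) * B0 L lam := rfl
  rw [e, ENNReal.ofReal_mul (Real.sqrt_nonneg _)]
  refine (h.timeAvg_J_one_le_mul hL hlam ht₀).trans ?_
  gcongr
  exact (h.timeAvg_J_zero_le hL hlam ht₀).trans (h.asymp_J_zero_le hL hlam)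

lemma IsSolution.timeAvg_J_three_le (hL : 0 < L) (hlam : 0 < lam) (ht₀ : 0 < t₀)
    (h : IsSolution L lam u₀ u) :
    timeAvg t₀ (fun t => J L 3 (u t)) ≤ timeAvg t₀ (fun t => J L 2 (u t))
      + ENNReal.ofReal lam * timeAvg t₀ (fun t => J L 1 (u t))
      + ENNReal.ofReal √(24 / Real.pi) * timeAvg t₀ (fun t => J L 2 (u t))
        * asymp (fun t => J L 0 (u t)) ^ (1 / 2 : ℝ) := by
  have c0 := h.continuousOn_J 0
  have c1 := h.continuousOn_J 1
  have c2 := h.continuousOn_J 2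
  have cs : ContinuousOn (fun t => √(J L 0 (u t))) (Set.Ioi 0) := c0.sqrt
  have n1 : ∀ t, 0 ≤ J L 1 (u t) := fun t => J_nonneg 1
  have n2 : ∀ t, 0 ≤ J L 2 (u t) := fun t => J_nonneg 2
  have hs : asymp (fun t => √(J L 0 (u t))) = asymp (fun t => J L 0 (u t)) ^ (1 / 2 : ℝ) := by
    rw [asymp, asymp, ← limsup_rpow _ (by norm_num)]
    congr 1
    funext t
    rw [Real.sqrt_eq_rpow, ENNReal.ofReal_rpow_of_nonneg (J_nonneg 0) (by norm_num)]
  have h1 : timeAvg t₀ (fun t => J L 3 (u t)) ≤ timeAvg t₀ (fun t => J L 2 (u t)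
      + lam * J L 1 (u t) + √(24 / Real.pi) * (J L 2 (u t) * √(J L 0 (u t)))) := by
    refine timeAvg_le_of_deriv_le (y := fun t => 1 / 2 * J L 1 (u t))
      (y' := fun t => 1 / 2 * (2 * ∫ p in cell L, -(lap (u t) p * dt u t p))) ht₀
      (h.continuousOn_J 3) ((c2.add (continuousOn_const.mul c1)).add
        (continuousOn_const.mul (c2.mul cs))) (fun t _ => J_nonneg 3) (fun t _ => ?_)
      (fun t _ => mul_nonneg (by norm_num) (n1 t))
      (fun t ht => (h.isSmoothFamily.hasDerivAt_J_one hL.le ht).const_mul _) fun t ht => ?_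
    · have := n1 t
      have := n2 t
      positivity
    · linarith [h.integral_neg_lap_mul_dt_le hL ht]
  have h2 : timeAvg t₀ (fun t => J L 2 (u t) * √(J L 0 (u t)))
      ≤ timeAvg t₀ (fun t => J L 2 (u t)) * asymp (fun t => J L 0 (u t)) ^ (1 / 2 : ℝ) := by
    rw [← hs]
    refine timeAvg_mul_le ht₀ c2 cs (fun t _ => n2 t)
      ((h.timeAvg_J_two_le_B2 hL hlam ht₀).trans_lt ENNReal.ofReal_lt_top).ne ?_
    rw [hs]
    exact ENNReal.rpow_ne_top_of_nonneg (by norm_num)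
      ((h.asymp_J_zero_le hL hlam).trans_lt ENNReal.ofReal_lt_top).ne
  refine h1.trans ((timeAvg_add_le (fun t _ => add_nonneg (n2 t) (mul_nonneg hlam.le (n1 t)))
    (fun t _ => mul_nonneg (Real.sqrt_nonneg _) (mul_nonneg (n2 t) (Real.sqrt_nonneg _)))
    (aemeasurable_Ioi ht₀ (c2.add (continuousOn_const.mul c1)))).trans (add_le_add ?_ ?_))
  · refine (timeAvg_add_le (fun t _ => n2 t) (fun t _ => mul_nonneg hlam.le (n1 t))
      (aemeasurable_Ioi ht₀ c2)).trans_eq ?_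
    rw [timeAvg_const_mul hlam.le]
  · rw [timeAvg_const_mul (Real.sqrt_nonneg _), mul_assoc]
    gcongr

lemma IsSolution.timeAvg_J_three_le_B3 (hL : 0 < L) (hlam : 0 < lam) (ht₀ : 0 < t₀)
    (h : IsSolution L lam u₀ u) :
    timeAvg t₀ (fun t => J L 3 (u t)) ≤ ENNReal.ofReal (B3 L lam) := by
  have hpi := Real.pi_pos
  have hB1 := B1_nonneg L hlam
  have hB2 : 0 ≤ B2 L lam := by unfold B2; positivity
  have e : B3 L lam = B2 L lam + lam * B1 L lam
      + √(24 / Real.pi) * B2 L lam * B0 L lam ^ (1 / 2 : ℝ) := by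
    have h1 : B0 L lam ^ (1 / 2 : ℝ) = L * √(lam + 1 / 4) := by
      rw [← Real.sqrt_eq_rpow, B0, Real.sqrt_mul (by positivity), Real.sqrt_sq hL.le]
    have h2 : √(2 * lam + 1) ^ 2 = 2 * lam + 1 := Real.sq_sqrt (by positivity)
    rw [h1, B3, B2, B1]
    linear_combination (L ^ 2 * (lam + 1 / 4) * (1 + √(24 / Real.pi) * L * √(lam + 1 / 4))) * h2
  have hr : 0 ≤ B0 L lam ^ (1 / 2 : ℝ) := Real.rpow_nonneg (B0_nonneg L hlam) _
  rw [e, ENNReal.ofReal_add (by positivity) (by positivity),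
    ENNReal.ofReal_add (by positivity) (by positivity), ENNReal.ofReal_mul hlam.le,
    ENNReal.ofReal_mul (by positivity), ENNReal.ofReal_mul (by positivity),
    ← ENNReal.ofReal_rpow_of_nonneg (B0_nonneg L hlam) (by norm_num)]
  refine (h.timeAvg_J_three_le hL hlam ht₀).trans ?_
  gcongr
  · exact h.timeAvg_J_two_le_B2 hL hlam ht₀
  · exact h.timeAvg_J_one_le_B1 hL hlam ht₀
  · exact h.timeAvg_J_two_le_B2 hL hlam ht₀
  · exact h.asymp_J_zero_le hL hlam

lemma IsSolution.crestAvg_le (hL : 0 < L) (ht₀ : 0 < t₀) (h : IsSolution L lam u₀ u) :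
    crestAvg L t₀ u ≤ 1 + crestFluct L t₀ u := by
  refine (timeAvg_mono fun t ht => crest_le hL (h.isSmoothPeriodic (ht₀.trans ht))).trans
    ((timeAvg_add_le (fun _ _ => zero_le_one) (fun t _ => ?_) aemeasurable_const).trans_eq ?_)
  · exact mul_nonneg hL.le (div_nonneg supNorm_nonneg (Real.sqrt_nonneg _))
  · rw [timeAvg_const, ENNReal.ofReal_one]
    rfl

lemma IsSolution.one_le_crestAvg (hL : 0 < L) (ht₀ : 0 < t₀) (h : IsSolution L lam u₀ u)
    (hn : NoExpDecay L u) : 1 ≤ crestAvg L t₀ u := by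
  rw [← ENNReal.ofReal_one, ← timeAvg_const (t₀ := t₀)]
  exact timeAvg_mono fun t ht => one_le_crest hL (h.isSmoothPeriodic (ht₀.trans ht))
    (h.J_zero_pos hL hn (ht₀.trans ht))

lemma IsSolution.crestFluct_le (hL : 0 < L) (ht₀ : 0 < t₀) (h : IsSolution L lam u₀ u) :
    crestFluct L t₀ u ≤ ENNReal.ofReal (Real.pi ^ (-(1 / 2) : ℝ) * L)
      * timeAvg t₀ (fun t => (J L 2 (u t) / J L 0 (u t)) ^ (1 / 4 : ℝ)) := by
  have := Real.pi_pos
  rw [← timeAvg_const_mul (by positivity)]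
  exact timeAvg_mono fun t ht => crest_fluct_le hL (h.isSmoothPeriodic (ht₀.trans ht))

lemma IsSolution.timeAvg_ratio_rpow_le (ht₀ : 0 < t₀) (h : IsSolution L lam u₀ u) :
    timeAvg t₀ (fun t => (J L 2 (u t) / J L 0 (u t)) ^ (1 / 4 : ℝ))
      ≤ timeAvg t₀ (fun t => J L 2 (u t) / J L 0 (u t)) ^ (1 / 4 : ℝ) := by
  have hpq : (4 : ℝ).HolderConjugate (4 / 3) := by
    rw [Real.holderConjugate_iff]; norm_num
  have h1 : timeAvg t₀ (fun _ => 1) = 1 := by rw [timeAvg_const, ENNReal.ofReal_one]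
  have := timeAvg_rpow_mul_rpow_le (t₀ := t₀) (F := fun t => J L 2 (u t) / J L 0 (u t))
    (G := fun _ => 1) hpq (fun t _ => div_nonneg (J_nonneg 2) (J_nonneg 0))
    (fun _ _ => zero_le_one)
    ((aemeasurable_Ioi ht₀ (h.continuousOn_J 2)).div (aemeasurable_Ioi ht₀ (h.continuousOn_J 0)))
    aemeasurable_const (by rw [h1]; exact ENNReal.one_ne_top) (Or.inr (by rw [h1]; exact one_ne_zero))
  simpa only [Real.one_rpow, mul_one, h1, ENNReal.one_rpow] using this

lemma IsSolution.crestFluct_le_of_le (hL : 0 < L) (hlam : 0 < lam) (ht₀ : 0 < t₀)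
    (h : IsSolution L lam u₀ u) (hn : NoExpDecay L u) {X : ℝ} (hX : 2 * lam + 1 ≤ X) :
    crestFluct L t₀ u ≤ ENNReal.ofReal (Real.pi ^ (-(1 / 2) : ℝ) * L * X ^ (1 / 4 : ℝ)) := by
  have hpi := Real.pi_pos
  have hX0 : 0 ≤ X := by linarith
  rw [ENNReal.ofReal_mul (by positivity), ← ENNReal.ofReal_rpow_of_nonneg hX0 (by norm_num)]
  refine (h.crestFluct_le hL ht₀).trans ?_
  gcongr
  refine (h.timeAvg_ratio_rpow_le ht₀).trans ?_
  gcongr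
  exact (h.timeAvg_ratio_le hL hlam ht₀ hn).trans (ENNReal.ofReal_le_ofReal hX)

end averages

end MKS

theorem mainTheorem3 (L : ℝ) (hL : 0 < L) :
    (∀ lam : ℝ, 0 < lam → ∀ (u₀ : ℝ × ℝ → ℝ) (u : ℝ → ℝ × ℝ → ℝ), MKS.IsSolution L lam u₀ u →
      ∀ t₀ : ℝ, 0 < t₀ →
        let J : ℕ → ℝ → ℝ := fun n t => MKS.J L n (u t)
        let avg : (ℝ → ℝ) → ℝ≥0∞ := MKS.timeAvg t₀
        let J0bar : ℝ≥0∞ := MKS.asymp (J 0)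
        -- the crest factor through the quotient of norms
        MKS.crestAvg L t₀ u ≤ 1 + MKS.crestFluct L t₀ u ∧
        MKS.crestFluct L t₀ u ≤
          ENNReal.ofReal (Real.pi ^ (-(1 / 2) : ℝ) * L)
            * avg (fun t => (J 2 t / J 0 t) ^ (1 / 4 : ℝ)) ∧
        ENNReal.ofReal (Real.pi ^ (-(1 / 2) : ℝ) * L)
            * avg (fun t => (J 2 t / J 0 t) ^ (1 / 4 : ℝ)) ≤
          ENNReal.ofReal (Real.pi ^ (-(1 / 2) : ℝ) * L)
            * (avg fun t => J 2 t / J 0 t) ^ (1 / 4 : ℝ) ∧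
        -- the estimate of the zeroth norm
        avg (J 0) ≤ J0bar ∧
        J0bar ≤ ENNReal.ofReal (MKS.B0 L lam) ∧
        -- the estimate of the averaged second norm
        avg (J 2) ≤ ENNReal.ofReal (2 * lam + 1) * avg (J 0) ∧
        avg (J 2) ≤ ENNReal.ofReal (MKS.B2 L lam) ∧
        -- the estimate of the averaged first norm
        avg (J 1) ≤ avg (J 2) ^ (1 / 2 : ℝ) * avg (J 0) ^ (1 / 2 : ℝ) ∧
        avg (J 1) ≤ ENNReal.ofReal √(2 * lam + 1) * avg (J 0) ∧
        avg (J 1) ≤ ENNReal.ofReal (MKS.B1 L lam) ∧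
        -- the estimate of the averaged third norm
        avg (J 3) ≤ avg (J 2) + ENNReal.ofReal lam * avg (J 1)
          + ENNReal.ofReal √(24 / Real.pi) * avg (J 2) * J0bar ^ (1 / 2 : ℝ) ∧
        avg (J 3) ≤ ENNReal.ofReal (MKS.B3 L lam) ∧
        -- the resulting explicit estimates
        (MKS.NoExpDecay L u →
          (avg fun t => J 2 t / J 0 t) ≤
            ENNReal.ofReal (2 * lam + 1) + ENNReal.ofReal (156 / Real.pi) * avg (J 1)
              + ENNReal.ofReal (10 / √Real.pi)
                * avg (J 3) ^ (1 / 4 : ℝ) * avg (J 1) ^ (1 / 4 : ℝ) ∧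
          MKS.crestFluct L t₀ u ≤
            ENNReal.ofReal (Real.pi ^ (-(1 / 2) : ℝ) * L *
              ((2 * lam + 1) + 156 / Real.pi * MKS.B1 L lam
                + 10 / √Real.pi * MKS.B3 L lam ^ (1 / 4 : ℝ)
                  * MKS.B1 L lam ^ (1 / 4 : ℝ)) ^ (1 / 4 : ℝ)))) ∧
    -- the growth in the bifurcation parameter
    (∃ K : ℝ, ∀ lam : ℝ, 1 ≤ lam → ∀ (u₀ : ℝ × ℝ → ℝ) (u : ℝ → ℝ × ℝ → ℝ),
      MKS.IsSolution L lam u₀ u → MKS.NoExpDecay L u → ∀ t₀ : ℝ, 0 < t₀ →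
        MKS.crestFluct L t₀ u ≤ ENNReal.ofReal (K * lam ^ (3 / 8 : ℝ)) ∧
        1 ≤ MKS.crestAvg L t₀ u ∧
        MKS.crestAvg L t₀ u ≤ 1 + ENNReal.ofReal (K * lam ^ (3 / 8 : ℝ))) := by
  have hpi := Real.pi_pos
  refine ⟨fun lam hlam u₀ u h t₀ ht₀ => ?_,
    Real.pi ^ (-(1 / 2) : ℝ) * L * 3 ^ (1 / 4 : ℝ), fun lam hlam u₀ u h hn t₀ ht₀ => ?_⟩
  · have hB1 := MKS.B1_nonneg L hlam
    have hB3 := MKS.B3_nonneg hL hlam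
    refine ⟨h.crestAvg_le hL ht₀, h.crestFluct_le hL ht₀,
      mul_le_mul_right (h.timeAvg_ratio_rpow_le ht₀) _, h.timeAvg_J_zero_le hL hlam ht₀,
      h.asymp_J_zero_le hL hlam, h.timeAvg_J_two_le hL hlam ht₀, h.timeAvg_J_two_le_B2 hL hlam ht₀,
      h.timeAvg_J_one_le hL hlam ht₀, h.timeAvg_J_one_le_mul hL hlam ht₀,
      h.timeAvg_J_one_le_B1 hL hlam ht₀, h.timeAvg_J_three_le hL hlam ht₀,
      h.timeAvg_J_three_le_B3 hL hlam ht₀, fun hn => ⟨?_, ?_⟩⟩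
    · rw [add_assoc]
      exact (h.timeAvg_ratio_le hL hlam ht₀ hn).trans le_self_add
    · refine h.crestFluct_le_of_le hL hlam ht₀ hn ?_
      rw [add_assoc]
      exact le_add_of_nonneg_right (by positivity)
  · have hlam0 : 0 < lam := by linarith
    have hK : MKS.crestFluct L t₀ u ≤ ENNReal.ofReal
        (Real.pi ^ (-(1 / 2) : ℝ) * L * 3 ^ (1 / 4 : ℝ) * lam ^ (3 / 8 : ℝ)) := by
      refine (h.crestFluct_le_of_le hL hlam0 ht₀ hn (X := 3 * lam) (by linarith)).trans
        (ENNReal.ofReal_le_ofReal ?_)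
      rw [Real.mul_rpow (by norm_num) hlam0.le, ← mul_assoc]
      exact mul_le_mul_of_nonneg_left
        (Real.rpow_le_rpow_of_exponent_le hlam (by norm_num)) (by positivity)
    exact ⟨hK, h.one_le_crestAvg hL ht₀ hn,
      (h.crestAvg_le hL ht₀).trans (add_le_add le_rfl hK)⟩
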